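/- Let $d\in\mathbb{N}_0$. Let $I$ be the set of all pairs $k=(k_1,k_2)$ with $k_1\in\mathbb{N}_0$ and $k_2\in C^\infty(\mathbb{R}^d)$, $k_2(r)\ge 1$ for all $r\in\mathbb{R}^d$. For $k\in I$ and a real-valued test function $f\in C_c^\infty(\mathbb{R}^d)$ put $$\|f\|_{H_k}:=\Big(\sum_{\beta\in\mathbb{N}_0^d,\ |\beta|\le k_1}\int_{\mathbb{R}^d}|(D^\beta f)(r)|^2\,k_2(r)\,dr\Big)^{1/2},$$ the norm of the weighted Sobolev space $H_k=W_2^{k_1}(\mathbb{R}^d,k_2(r)\,dr)$, the completion of $C_c^\infty(\mathbb{R}^d)$ in this norm. Let $\mathscr{D}_{proj}(\mathbb{R}^d)$ be $C_c^\infty(\mathbb{R}^d)$ with the projective limit topology, i.e. the locally convex topology generated by all the norms $\|\cdot\|_{H_k}$, $k\in I$. A subset of $\mathscr{D}_{proj}(\mathbb{R}^d)$ is called total if its linear span is dense in $\mathscr{D}_{proj}(\mathbb{R}^d)$. For a sequence $(M_n)_{n\in\mathbb{N}_0}$ of positive numbers let $C\{M_n\}$ be the class of all $f\in C^\infty(\mathbb{R})$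 for which there are constants $\beta_f,B_f>0$ with $\|D^nf\|_\infty\le\beta_f B_f^nM_n$ for all $n\in\mathbb{N}_0$. The sequence $(M_n)$ is called quasi-analytic if the only $f\in C\{M_n\}$ with $(D^nf)(0)=0$ for all $n\in\mathbb{N}_0$ is $f=0$. **Lemma.** Let $(c_n)_{n\in\mathbb{N}_0}$ be a (not necessarily strictly) increasing sequence of positive numbers that is not quasi-analytic, and let $k^{(n)}=(k_1^{(n)},k_2^{(n)})\in I$ for each $n\in\mathbb{N}_0$. Then the set $$E:=\Big\{f\in C_c^\infty(\mathbb{R}^d)\ \Big|\ \forall n\in\mathbb{N}_0:\ \|f\|_{H_{k^{(n)}}}\le \big(c_{k_1^{(n)}}\big)^d\ \sup_{z\in\mathbb{R}^d,\ \|z\|\le n}\ \sup_{x\in[-1,1]^d}\sqrt{k_2^{(n)}(z+x)}\Big\}$$ is total in $\mathscr{D}_{proj}(\mathbb{R}^d)$. -/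

import Mathlib

open MeasureTheory
open scoped ContDiff Distributions

/-! ### Quasi-analyticity -/

/-- The class `C{M_n}` of all `f ∈ C^∞(ℝ)` such that `‖Dⁿ f‖_∞ ≤ β Bⁿ M_n` for every `n`,
where the constants `β, B > 0` depend only on `f`. -/
def carlemanClass (M : ℕ → ℝ) : Set (ℝ → ℝ) :=
  {f | ContDiff ℝ ∞ f ∧ ∃ β B : ℝ, 0 < β ∧ 0 < B ∧
    ∀ (n : ℕ) (x : ℝ), |iteratedDeriv n f x| ≤ β * B ^ n * M n}

/-- A class of functions is quasi-analytic if its only member which vanishes together with all its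
derivatives at `0` is the zero function. -/
def IsQuasiAnalyticClass (C : Set (ℝ → ℝ)) : Prop :=
  ∀ f ∈ C, (∀ n : ℕ, iteratedDeriv n f 0 = 0) → ∀ x : ℝ, f x = 0

/-- A sequence `M` is quasi-analytic if the class `C{M_n}` is. -/
def IsQuasiAnalytic (M : ℕ → ℝ) : Prop :=
  IsQuasiAnalyticClass (carlemanClass M)

/-! ### Partial derivatives -/

/-- The partial derivative `∂f/∂r_i`. -/
noncomputable def partialD {d : ℕ} (i : Fin d) (f : EuclideanSpace ℝ (Fin d) → ℝ) :
    EuclideanSpace ℝ (Fin d) → ℝ :=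
  fun r => fderiv ℝ f r (EuclideanSpace.single i 1)

/-- The partial derivative `D^β f = ∂^{|β|} f / ∂r_1^{β_1} ⋯ ∂r_d^{β_d}`. -/
noncomputable def multiD {d : ℕ} (β : Fin d → ℕ) (f : EuclideanSpace ℝ (Fin d) → ℝ) :
    EuclideanSpace ℝ (Fin d) → ℝ :=
  (List.finRange d).foldr (fun i g => (partialD i)^[β i] g) f

/-- The finite set of all multi-indices `β ∈ ℕ₀^d` with `|β| ≤ k`. -/
def multiIndices (d k : ℕ) : Finset (Fin d → ℕ) :=
  (Fintype.piFinset fun _ => Finset.range (k + 1)).filter fun β => ∑ i, β i ≤ k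

theorem mem_multiIndices {d k : ℕ} {β : Fin d → ℕ} :
    β ∈ multiIndices d k ↔ ∑ i, β i ≤ k := by
  simp only [multiIndices, Finset.mem_filter, Fintype.mem_piFinset, Finset.mem_range,
    and_iff_right_iff_imp]
  intro h i
  have := Finset.single_le_sum (f := β) (fun _ _ => Nat.zero_le _) (Finset.mem_univ i)
  omega

theorem contDiff_partialD {d : ℕ} (i : Fin d) {f : EuclideanSpace ℝ (Fin d) → ℝ}
    (hf : ContDiff ℝ ∞ f) : ContDiff ℝ ∞ (partialD i f) :=
  (hf.fderiv_right (m := ∞) (by simp)).clm_apply contDiff_const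

theorem partialD_add {d : ℕ} (i : Fin d) {f g : EuclideanSpace ℝ (Fin d) → ℝ}
    (hf : ContDiff ℝ ∞ f) (hg : ContDiff ℝ ∞ g) :
    partialD i (f + g) = partialD i f + partialD i g := by
  funext r
  simp only [partialD, Pi.add_apply]
  rw [fderiv_add (hf.differentiable (by simp) r) (hg.differentiable (by simp) r)]
  rfl

theorem partialD_smul {d : ℕ} (i : Fin d) (a : ℝ) {f : EuclideanSpace ℝ (Fin d) → ℝ}
    (hf : ContDiff ℝ ∞ f) : partialD i (a • f) = a • partialD i f := by
  funext r
  simp only [partialD, Pi.smul_apply]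
  rw [fderiv_const_smul (hf.differentiable (by simp) r)]
  rfl

theorem hasCompactSupport_partialD {d : ℕ} (i : Fin d) {f : EuclideanSpace ℝ (Fin d) → ℝ}
    (hf : HasCompactSupport f) : HasCompactSupport (partialD i f) :=
  hf.fderiv_apply ℝ _

theorem contDiff_iterate_partialD {d : ℕ} (i : Fin d) (n : ℕ)
    {f : EuclideanSpace ℝ (Fin d) → ℝ} (hf : ContDiff ℝ ∞ f) :
    ContDiff ℝ ∞ ((partialD i)^[n] f) := by
  induction n with
  | zero => exact hf
  | succ n ih => rw [Function.iterate_succ_apply']; exact contDiff_partialD i ih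

theorem iterate_partialD_add {d : ℕ} (i : Fin d) (n : ℕ) {f g : EuclideanSpace ℝ (Fin d) → ℝ}
    (hf : ContDiff ℝ ∞ f) (hg : ContDiff ℝ ∞ g) :
    (partialD i)^[n] (f + g) = (partialD i)^[n] f + (partialD i)^[n] g := by
  induction n with
  | zero => rfl
  | succ n ih =>
    simp only [Function.iterate_succ_apply', ih]
    exact partialD_add i (contDiff_iterate_partialD i n hf) (contDiff_iterate_partialD i n hg)

theorem iterate_partialD_smul {d : ℕ} (i : Fin d) (n : ℕ) (a : ℝ)
    {f : EuclideanSpace ℝ (Fin d) → ℝ} (hf : ContDiff ℝ ∞ f) :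
    (partialD i)^[n] (a • f) = a • (partialD i)^[n] f := by
  induction n with
  | zero => rfl
  | succ n ih =>
    simp only [Function.iterate_succ_apply', ih]
    exact partialD_smul i a (contDiff_iterate_partialD i n hf)

theorem hasCompactSupport_iterate_partialD {d : ℕ} (i : Fin d) (n : ℕ)
    {f : EuclideanSpace ℝ (Fin d) → ℝ} (hf : HasCompactSupport f) :
    HasCompactSupport ((partialD i)^[n] f) := by
  induction n with
  | zero => exact hf
  | succ n ih => rw [Function.iterate_succ_apply']; exact hasCompactSupport_partialD i ih

theorem contDiff_multiD {d : ℕ} (β : Fin d → ℕ) {f : EuclideanSpace ℝ (Fin d) → ℝ}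
    (hf : ContDiff ℝ ∞ f) : ContDiff ℝ ∞ (multiD β f) := by
  unfold multiD
  induction List.finRange d with
  | nil => exact hf
  | cons i l ih => exact contDiff_iterate_partialD i (β i) ih

theorem hasCompactSupport_multiD {d : ℕ} (β : Fin d → ℕ) {f : EuclideanSpace ℝ (Fin d) → ℝ}
    (hf : HasCompactSupport f) : HasCompactSupport (multiD β f) := by
  unfold multiD
  induction List.finRange d with
  | nil => exact hf
  | cons i l ih => exact hasCompactSupport_iterate_partialD i (β i) ih

theorem multiD_add {d : ℕ} (β : Fin d → ℕ) {f g : EuclideanSpace ℝ (Fin d) → ℝ}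
    (hf : ContDiff ℝ ∞ f) (hg : ContDiff ℝ ∞ g) :
    multiD β (f + g) = multiD β f + multiD β g := by
  have key : ∀ l : List (Fin d),
      ContDiff ℝ ∞ (l.foldr (fun i g => (partialD i)^[β i] g) f) ∧
      ContDiff ℝ ∞ (l.foldr (fun i g => (partialD i)^[β i] g) g) ∧
      l.foldr (fun i g => (partialD i)^[β i] g) (f + g) =
        l.foldr (fun i g => (partialD i)^[β i] g) f +
          l.foldr (fun i g => (partialD i)^[β i] g) g := by
    intro l
    induction l with
    | nil => exact ⟨hf, hg, rfl⟩
    | cons i l ih =>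
      obtain ⟨h1, h2, h3⟩ := ih
      refine ⟨contDiff_iterate_partialD i _ h1, contDiff_iterate_partialD i _ h2, ?_⟩
      simp only [List.foldr_cons, h3]
      exact iterate_partialD_add i _ h1 h2
  exact (key _).2.2

theorem multiD_smul {d : ℕ} (β : Fin d → ℕ) (a : ℝ) {f : EuclideanSpace ℝ (Fin d) → ℝ}
    (hf : ContDiff ℝ ∞ f) : multiD β (a • f) = a • multiD β f := by
  have key : ∀ l : List (Fin d),
      ContDiff ℝ ∞ (l.foldr (fun i g => (partialD i)^[β i] g) f) ∧
      l.foldr (fun i g => (partialD i)^[β i] g) (a • f) =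
        a • l.foldr (fun i g => (partialD i)^[β i] g) f := by
    intro l
    induction l with
    | nil => exact ⟨hf, rfl⟩
    | cons i l ih =>
      obtain ⟨h1, h3⟩ := ih
      refine ⟨contDiff_iterate_partialD i _ h1, ?_⟩
      simp only [List.foldr_cons, h3]
      exact iterate_partialD_smul i _ a h1
  exact (key _).2

/-! ### The space of test functions and its weighted Sobolev norms -/

/-- The index set `I`: pairs `k = (k₁, k₂)` of an order `k₁ ∈ ℕ₀` and a weight
`k₂ ∈ C^∞(ℝ^d)` with `k₂ ≥ 1`. -/
structure SobolevIndex (d : ℕ) where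
  /-- The order `k₁`. -/
  order : ℕ
  /-- The weight `k₂`. -/
  weight : EuclideanSpace ℝ (Fin d) → ℝ
  smooth : ContDiff ℝ ∞ weight
  one_le : ∀ r, 1 ≤ weight r

/-- The vector space `C_c^∞(ℝ^d)` of real-valued test functions. It is kept apart from Mathlib's
type `𝓓(⊤, ℝ)` because the latter carries the inductive limit topology. -/
def DProj (d : ℕ) : Type :=
  𝓓((⊤ : TopologicalSpace.Opens (EuclideanSpace ℝ (Fin d))), ℝ)

namespace DProj

variable {d : ℕ}

noncomputable instance : AddCommGroup (DProj d) :=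
  inferInstanceAs
    (AddCommGroup 𝓓((⊤ : TopologicalSpace.Opens (EuclideanSpace ℝ (Fin d))), ℝ))

noncomputable instance : Module ℝ (DProj d) :=
  inferInstanceAs
    (Module ℝ 𝓓((⊤ : TopologicalSpace.Opens (EuclideanSpace ℝ (Fin d))), ℝ))

instance : FunLike (DProj d) (EuclideanSpace ℝ (Fin d)) ℝ where
  coe f := TestFunction.toFun f
  coe_injective := by
    intro f g h
    cases f
    cases g
    congr

theorem contDiff (f : DProj d) : ContDiff ℝ ∞ f :=
  TestFunction.contDiff' f

theorem hasCompactSupport (f : DProj d) : HasCompactSupport f :=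
  TestFunction.hasCompactSupport' f

theorem coe_add (f g : DProj d) : ⇑(f + g) = ⇑f + ⇑g := rfl

theorem coe_smul (a : ℝ) (f : DProj d) : ⇑(a • f) = a • ⇑f := rfl

/-- The inner product `∑_{|β| ≤ k₁} ∫ (D^β f)(r) (D^β g)(r) k₂(r) dr` of
`W_2^{k₁}(ℝ^d, k₂(r) dr)` on test functions. -/
noncomputable def sobolevInner (k : SobolevIndex d) (f g : DProj d) : ℝ :=
  ∑ β ∈ multiIndices d k.order, ∫ r, multiD β f r * multiD β g r * k.weight r

/-- The norm `(∑_{|β| ≤ k₁} ∫ |(D^β f)(r)|² k₂(r) dr)^{1/2}` of `W_2^{k₁}(ℝ^d, k₂(r) dr)` on test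
functions. -/
noncomputable def sobolevNorm (k : SobolevIndex d) (f : DProj d) : ℝ :=
  √(∑ β ∈ multiIndices d k.order, ∫ r, |multiD β f r| ^ 2 * k.weight r)

theorem sobolevNorm_eq (k : SobolevIndex d) (f : DProj d) :
    sobolevNorm k f = √(sobolevInner k f f) := by
  simp only [sobolevNorm, sobolevInner, pow_two, abs_mul_abs_self]

theorem integrable_sobolev (k : SobolevIndex d) (β : Fin d → ℕ) (f g : DProj d) :
    Integrable (fun r => multiD β f r * multiD β g r * k.weight r) := by
  apply Continuous.integrable_of_hasCompactSupport
  · exact ((contDiff_multiD β f.contDiff).continuous.mul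
      (contDiff_multiD β g.contDiff).continuous).mul k.smooth.continuous
  · exact ((hasCompactSupport_multiD β f.hasCompactSupport).mul_right).mul_right

theorem sobolevInner_add_left (k : SobolevIndex d) (f g h : DProj d) :
    sobolevInner k (f + g) h = sobolevInner k f h + sobolevInner k g h := by
  unfold sobolevInner
  rw [← Finset.sum_add_distrib]
  refine Finset.sum_congr rfl fun β _ => ?_
  rw [← integral_add (integrable_sobolev k β f h) (integrable_sobolev k β g h)]
  refine integral_congr_ae (Filter.Eventually.of_forall fun r => ?_)
  simp only [coe_add, multiD_add β f.contDiff g.contDiff, Pi.add_apply]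
  ring

theorem sobolevInner_smul_left (k : SobolevIndex d) (a : ℝ) (f g : DProj d) :
    sobolevInner k (a • f) g = a * sobolevInner k f g := by
  unfold sobolevInner
  rw [Finset.mul_sum]
  refine Finset.sum_congr rfl fun β _ => ?_
  rw [← integral_const_mul]
  refine integral_congr_ae (Filter.Eventually.of_forall fun r => ?_)
  simp only [coe_smul, multiD_smul β a f.contDiff, Pi.smul_apply, smul_eq_mul]
  ring

/-- The positive semidefinite form underlying `sobolevNorm k`. -/
@[reducible]
noncomputable def sobolevCore (k : SobolevIndex d) : PreInnerProductSpace.Core ℝ (DProj d) where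
  inner := sobolevInner k
  conj_inner_symm f g := by
    simp only [sobolevInner, mul_comm, conj_trivial]
  re_inner_nonneg f := by
    refine Finset.sum_nonneg fun β _ => integral_nonneg fun r => ?_
    exact mul_nonneg (mul_self_nonneg _) (zero_le_one.trans (k.one_le r))
  add_left := sobolevInner_add_left k
  smul_left f g a := sobolevInner_smul_left k a f g

theorem sobolevNorm_add_le (k : SobolevIndex d) (f g : DProj d) :
    sobolevNorm k (f + g) ≤ sobolevNorm k f + sobolevNorm k g := by
  simp only [sobolevNorm_eq]
  exact @norm_add_le (DProj d)
    (@InnerProductSpace.Core.toSeminormedAddCommGroup ℝ _ _ _ _ (sobolevCore k)).toSeminormedAddGroup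
    f g

theorem sobolevNorm_smul (k : SobolevIndex d) (a : ℝ) (f : DProj d) :
    sobolevNorm k (a • f) = ‖a‖ * sobolevNorm k f := by
  simp only [sobolevNorm, coe_smul, multiD_smul _ a f.contDiff, Pi.smul_apply, smul_eq_mul,
    abs_mul, mul_pow, mul_assoc, integral_const_mul, ← Finset.mul_sum]
  rw [Real.sqrt_mul (by positivity), Real.sqrt_sq (abs_nonneg a), Real.norm_eq_abs]

/-- `sobolevNorm k` as a seminorm on `C_c^∞(ℝ^d)`. -/
noncomputable def sobolevSeminorm (d : ℕ) : SeminormFamily ℝ (DProj d) (SobolevIndex d) :=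
  fun k => Seminorm.of (sobolevNorm k) (sobolevNorm_add_le k) (sobolevNorm_smul k)

instance : Nonempty (SobolevIndex d) :=
  ⟨⟨0, fun _ => 1, contDiff_const, fun _ => le_rfl⟩⟩

/-- The projective limit topology `τ_proj` on `C_c^∞(ℝ^d)`, i.e. the coarsest topology for
which all the inclusions into the spaces `W_2^{k₁}(ℝ^d, k₂(r) dr)`, `(k₁, k₂) ∈ I`, are
continuous: the locally convex topology generated by all the norms `sobolevNorm k`, `k ∈ I`. -/
noncomputable instance : TopologicalSpace (DProj d) :=
  (sobolevSeminorm d).moduleFilterBasis.topology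

theorem withSeminorms (d : ℕ) : WithSeminorms (sobolevSeminorm d) :=
  ⟨rfl⟩

end DProj

/-! ### The set `E` -/

/-- The cube `[-1,1]^d`. -/
def cube (d : ℕ) : Set (EuclideanSpace ℝ (Fin d)) :=
  {x | ∀ i, x i ∈ Set.Icc (-1 : ℝ) 1}

/-- `sup_{‖z‖ ≤ n} sup_{x ∈ [-1,1]^d} √(w(z + x))`. -/
noncomputable def supSqrtWeight {d : ℕ} (n : ℕ) (w : EuclideanSpace ℝ (Fin d) → ℝ) : ℝ :=
  ⨆ z : Metric.closedBall (0 : EuclideanSpace ℝ (Fin d)) (n : ℝ), ⨆ x : cube d,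
    √(w ((z : EuclideanSpace ℝ (Fin d)) + (x : EuclideanSpace ℝ (Fin d))))

/-- The set of all test functions `f` such that, for every `n ∈ ℕ₀`,
`‖f‖_{k⁽ⁿ⁾} ≤ (c_{k₁⁽ⁿ⁾})^d · sup_{‖z‖ ≤ n} sup_{x ∈ [-1,1]^d} √(k₂⁽ⁿ⁾(z + x))`. -/
def boundedTestFunctions {d : ℕ} (c : ℕ → ℝ) (k : ℕ → SobolevIndex d) : Set (DProj d) :=
  {f | ∀ n : ℕ, DProj.sobolevNorm (k n) f ≤
    c (k n).order ^ d * supSqrtWeight n (k n).weight}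

/-- A set is total in a topological vector space if its linear span is dense. -/
def IsTotalSet {V : Type*} [AddCommGroup V] [Module ℝ V] [TopologicalSpace V] (E : Set V) : Prop :=
  Dense (Submodule.span ℝ E : Set V)

/-! A test function `f` lies in the span of the set as soon as the quotients of its norms by the
prescribed bounds are bounded in `n`, because a small multiple of `f` then satisfies all the bounds.
Once `n` exceeds the radius of the support, the supremum over `‖z‖ ≤ n` controls the weight on the
whole support, and the weight cancels from the quotient. What remains is controlled by derivative
bounds `|D^β f| ≤ C ∏ 2^{-β_i} c_{β_i}`: monotonicity of `c` gives `∏ c_{β_i} ≤ c_{k₁}^d`, and the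
geometric factors make the sum over `β` bounded independently of `k₁`. The finitely many smaller `n`
only enlarge the constant. This is `mem_span_boundedTestFunctions`.

It remains to approximate every test function by functions with such bounds. Convolution with a
product of one-dimensional mollifiers does this (`exists_mollification`): derivatives put on the
kernel give the bounds, derivatives put on the test function give uniform convergence of every
derivative within a fixed compact set, hence convergence in each weighted norm.

The mollifiers come from the Denjoy–Carleman theorem. Let `b n` be the infimum of `c m ^ (1/m)` over
`m > n`. A nonzero function of the class that is flat at `0` has a Laplace transform decaying so
fast in a half-plane that Jensen's inequality forces `∑ 1 / b n < ∞` (`summable_inv_of_flat`).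
Conversely, averaging a bump successively over intervals whose half-lengths are eventually `2 / b j`
yields a smooth compactly supported limit, each average paying for one derivative
(`exists_mollifier_of_not_isQuasiAnalytic`). -/

/-! ### Jensen's inequality and decay in a half-plane -/

/-- Jensen's inequality for the logarithm of the modulus of an analytic function; the majorant
is only needed off the zeros. -/
theorem log_norm_le_integral_of_circle {f : ℂ → ℂ} {R : ℝ} (hR : 0 < R)
    (hf : AnalyticOnNhd ℂ f (Metric.closedBall 0 R)) (h0 : f 0 ≠ 0) {U : ℝ → ℝ}
    (hU : IntervalIntegrable U volume 0 (2 * Real.pi))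
    (hle : ∀ θ ∈ Set.Icc 0 (2 * Real.pi), f (circleMap 0 R θ) ≠ 0 →
      Real.log ‖f (circleMap 0 R θ)‖ ≤ U θ) :
    Real.log ‖f 0‖ ≤ (2 * Real.pi)⁻¹ * ∫ θ in (0 : ℝ)..2 * Real.pi, U θ := by
  have hab : |R| = R := abs_of_pos hR
  have hf' : AnalyticOnNhd ℂ f (Metric.closedBall 0 |R|) := by rwa [hab]
  have jensen := hf'.circleAverage_log_norm hR.ne' h0
  -- Every zero `u` in the disc contributes `log (R / ‖u‖) ≥ 0` to Jensen's formula, so dropping the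
  -- zeros leaves an inequality.
  have hsum : 0 ≤ ∑ᶠ u, (MeromorphicOn.divisor f (Metric.closedBall 0 |R|) u : ℝ)
      * Real.log (R * ‖0 - u‖⁻¹) := by
    refine finsum_nonneg fun u => ?_
    by_cases hu : u ∈ Metric.closedBall (0 : ℂ) |R|
    · refine mul_nonneg (mod_cast MeromorphicOn.AnalyticOnNhd.divisor_nonneg hf' u) ?_
      -- At `u = 0` the term vanishes through the conventions `0⁻¹ = 0` and `log 0 = 0`.
      rcases eq_or_ne u 0 with rfl | hu0
      · simp
      · apply Real.log_nonneg
        have : 0 < ‖0 - u‖ := by simpa using hu0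
        rw [← div_eq_mul_inv, le_div_iff₀ this]
        simpa [hab] using hu
    · simp [hu]
  have hle0 : Real.log ‖f 0‖ ≤ Real.circleAverage (fun z => Real.log ‖f z‖) 0 R := by
    rw [jensen]; linarith
  refine hle0.trans ?_
  rw [Real.circleAverage_def, smul_eq_mul]
  refine mul_le_mul_of_nonneg_left ?_ (by positivity)
  have hint : CircleIntegrable (fun z => Real.log ‖f z‖) 0 R :=
    MeromorphicOn.circleIntegrable_log_norm fun z hz =>
      (hf' z (Metric.sphere_subset_closedBall hz)).meromorphicAt
  -- The zeros of `f` on the circle are discrete, hence null in `θ`; the majorant is therefore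
  -- needed only almost everywhere.
  have hcod := hf'.preimage_zero_mem_codiscreteWithin (x := 0) h0 (by simp)
    ((convex_closedBall (0 : ℂ) |R|).isConnected ⟨0, by simp⟩)
  have hcod2 := circleMap_preimage_codiscrete (c := 0) hR.ne'
    (Filter.codiscreteWithin_mono Metric.sphere_subset_closedBall hcod)
  have hae := ae_restrict_le_codiscreteWithin (μ := volume) (measurableSet_Icc
    (a := (0 : ℝ)) (b := 2 * Real.pi))
    (Filter.codiscreteWithin_mono (Set.subset_univ _) hcod2)
  refine intervalIntegral.integral_mono_ae_restrict (by positivity) hint hU ?_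
  filter_upwards [hae, ae_restrict_mem measurableSet_Icc] with θ h1 h2
  exact hle θ h2 (by simpa using h1)

/-- The Möbius map `w ↦ (1 - w)⁻¹` carries the unit disc to the half-plane `re > 1/2` and the
boundary point `1` to infinity, which transports Jensen's inequality to the half-plane. -/
theorem one_half_lt_re_inv_one_sub {w : ℂ} (hw : ‖w‖ < 1) : 1 / 2 < ((1 - w)⁻¹).re := by
  have h1 : (1 - w) ≠ 0 := by
    intro h
    rw [sub_eq_zero] at h
    simp [← h] at hw
  rw [Complex.inv_re, lt_div_iff₀ (Complex.normSq_pos.2 h1)]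
  have h2 : Complex.normSq w < 1 := by
    rw [Complex.normSq_eq_norm_sq]; nlinarith [norm_nonneg w]
  rw [Complex.normSq_apply] at *
  simp only [Complex.sub_re, Complex.one_re, Complex.sub_im, Complex.one_im, zero_sub] at *
  nlinarith

theorem norm_one_sub_circleMap_le {R θ : ℝ} (hR0 : 0 ≤ R) (hR : R ≤ 1) :
    ‖1 - circleMap 0 R θ‖ ≤ (1 - R) + |θ| := by
  have h : ‖Complex.exp (Complex.I * θ) - 1‖ ≤ ‖θ‖ := Real.norm_exp_I_mul_ofReal_sub_one_le
  have : 1 - circleMap 0 R θ = ((1 - R : ℝ) : ℂ) - R * (Complex.exp (Complex.I * θ) - 1) := by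
    simp only [circleMap, mul_comm Complex.I]; push_cast; ring
  rw [this]
  refine (norm_sub_le _ _).trans ?_
  rw [norm_mul, Complex.norm_real, Complex.norm_real, Real.norm_of_nonneg hR0,
    Real.norm_of_nonneg (by linarith)]
  rw [Real.norm_eq_abs] at h
  nlinarith [norm_nonneg (Complex.exp (Complex.I * θ) - 1)]

/-- A bounded analytic function on a half-plane, not identically zero, cannot decay too fast: if
`‖F z‖ ≤ K e^{-(n+1)}` as soon as `‖z‖ ≥ b n`, then `∑ 1 / b n` converges. -/
theorem summable_inv_of_decay_halfPlane {F : ℂ → ℂ}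
    (hF : DifferentiableOn ℂ F {z | 1 / 2 < z.re}) {y : ℝ} (hy : F (1 + y * Complex.I) ≠ 0)
    {b : ℕ → ℝ} (hb : ∀ n, 0 < b n) (hbm : Monotone b) {K : ℝ}
    (hK : ∀ z : ℂ, 1 / 2 < z.re → ‖F z‖ ≤ K)
    (hdec : ∀ (n : ℕ) (z : ℂ), 1 / 2 < z.re → b n ≤ ‖z‖ → ‖F z‖ ≤ K * Real.exp (-(n + 1))) :
    Summable fun n => (b n)⁻¹ := by
  -- The vertical shift moves the centre of the disc to `1 + iy`, where `F` does not vanish.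
  set G : ℂ → ℂ := fun w => F ((1 - w)⁻¹ + y * Complex.I) with hG
  have hG0 : G 0 ≠ 0 := by simpa [hG] using hy
  have hre : ∀ w : ℂ, ‖w‖ < 1 → 1 / 2 < ((1 - w)⁻¹ + y * Complex.I).re := fun w hw => by
    simpa using one_half_lt_re_inv_one_sub hw
  have hKpos : 0 < K := (norm_pos_iff.2 hG0).trans_le (hK _ (hre 0 (by simp)))
  have hGd : DifferentiableOn ℂ G (Metric.ball 0 1) := by
    refine hF.comp (t := {z | 1 / 2 < z.re}) ?_ fun w hw => hre w (by simpa using hw)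
    intro w hw
    have h1 : (1 - w) ≠ 0 := by
      intro h
      rw [sub_eq_zero] at h
      simp [← h] at hw
    exact (((differentiableAt_const (1 : ℂ)).sub differentiableAt_id).inv h1
      |>.add_const _).differentiableWithinAt
  have hGan : AnalyticOnNhd ℂ G (Metric.ball 0 1) := hGd.analyticOnNhd Metric.isOpen_ball
  -- Chosen so that `‖1 - w‖ ≤ a n` forces `‖(1 - w)⁻¹ + iy‖ ≥ b n`.
  set a : ℕ → ℝ := fun n => (b n + |y| + 1)⁻¹ with ha
  have hden : ∀ n, 0 < b n + |y| + 1 := fun n => by have := hb n; positivity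
  have hapos : ∀ n, 0 < a n := fun n => inv_pos.2 (hden n)
  have hale : ∀ n, a n ≤ 1 := fun n => inv_le_one_of_one_le₀ (by have := hb n; have := abs_nonneg y; linarith)
  have haanti : Antitone a := fun m n h => by
    apply inv_anti₀ (hden m); have := hbm h; linarith
  have key : ∀ N : ℕ, ∑ n ∈ Finset.range N, a n ≤ 4 * Real.pi * (Real.log K - Real.log ‖G 0‖) := by
    intro N
    -- With this radius, an angle `0 < θ ≤ a n / 2` with `n < N` puts the point within `a N / 2 + a
    -- n / 2 ≤ a n` of `1`.
    set R : ℝ := 1 - a N / 2 with hRdef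
    have hRpos : 0 < R := by have := hale N; rw [hRdef]; linarith
    have hRlt : R < 1 := by have := hapos N; rw [hRdef]; linarith
    -- The majorant loses `1` for each arc containing `θ`. Integrating it turns the arc lengths into
    -- the partial sum of `a`, bounded independently of `N`.
    set U : ℝ → ℝ := fun θ => Real.log K -
      ∑ n ∈ Finset.range N, (Set.Ioc 0 (a n / 2)).indicator (fun _ => (1 : ℝ)) θ with hU
    have hii : ∀ n, IntervalIntegrable ((Set.Ioc 0 (a n / 2)).indicator (fun _ => (1 : ℝ)))
        volume 0 (2 * Real.pi) := fun n =>
      ((integrable_indicator_iff measurableSet_Ioc).2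
        (integrableOn_const (by simp))).intervalIntegrable
    have hsumi : IntervalIntegrable (fun θ => ∑ n ∈ Finset.range N,
        (Set.Ioc 0 (a n / 2)).indicator (fun _ => (1 : ℝ)) θ) volume 0 (2 * Real.pi) := by
      simpa only [Finset.sum_fn] using IntervalIntegrable.sum (Finset.range N) fun n _ => hii n
    have hUi : IntervalIntegrable U volume 0 (2 * Real.pi) :=
      intervalIntegrable_const.sub (hsumi)
    have h := log_norm_le_integral_of_circle hRpos
      (hGan.mono (Metric.closedBall_subset_ball hRlt)) hG0 hUi ?_
    · have hint : ∫ θ in (0 : ℝ)..2 * Real.pi, U θ =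
          2 * Real.pi * Real.log K - ∑ n ∈ Finset.range N, a n / 2 := by
        rw [hU, intervalIntegral.integral_sub intervalIntegrable_const
          (hsumi),
          intervalIntegral.integral_finsetSum fun n _ => hii n]
        congr 1
        · simp
        · refine Finset.sum_congr rfl fun n _ => ?_
          rw [intervalIntegral.integral_of_le (by positivity),
            setIntegral_indicator measurableSet_Ioc]
          have : Set.Ioc 0 (2 * Real.pi) ∩ Set.Ioc 0 (a n / 2) = Set.Ioc 0 (a n / 2) := by
            rw [Set.inter_eq_right]
            refine Set.Ioc_subset_Ioc_right ?_
            have := hale n; have := Real.pi_gt_three; linarith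
          rw [this]
          have := hapos n
          simp
          linarith
      rw [hint, ← Finset.sum_div, inv_mul_eq_div, le_div_iff₀ (by positivity)] at h
      linarith
    · intro θ hθ hne
      have hnorm : ‖circleMap 0 R θ‖ < 1 := by simpa [abs_of_pos hRpos] using hRlt
      have hpos : 0 < ‖G (circleMap 0 R θ)‖ := norm_pos_iff.2 hne
      set S := (Finset.range N).filter fun n => θ ∈ Set.Ioc 0 (a n / 2) with hS
      have hUθ : U θ = Real.log K - S.card := by
        simp only [hU, hS, Set.indicator_apply, Finset.sum_boole]
      rw [hUθ]
      rcases S.eq_empty_or_nonempty with hE | hne'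
      · rw [hE]
        simpa using Real.log_le_log hpos (hK _ (hre _ hnorm))
      · have hmem := S.max'_mem hne'
        -- The smallest arc containing `θ` has index `m`, and at most `m + 1` arcs contain `θ`:
        -- exactly the exponent that the decay hypothesis provides at index `m`.
        set m := S.max' hne' with hm
        have hcard : S.card ≤ m + 1 := by
          have : S ⊆ Finset.range (m + 1) := fun n hn =>
            Finset.mem_range.2 (Nat.lt_succ_of_le (S.le_max' n hn))
          simpa using Finset.card_le_card this
        simp only [hS, Finset.mem_filter, Finset.mem_range, Set.mem_Ioc] at hmem
        have hdist : ‖1 - circleMap 0 R θ‖ ≤ a m := by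
          have h1 := norm_one_sub_circleMap_le (θ := θ) hRpos.le hRlt.le
          rw [abs_of_nonneg hθ.1] at h1
          have h2 := haanti hmem.1.le
          have : 1 - R = a N / 2 := by rw [hRdef]; ring
          linarith [hmem.2.2]
        have h1 : (1 - circleMap 0 R θ) ≠ 0 := by
          intro h
          rw [sub_eq_zero] at h
          simp [← h] at hnorm
        have hbig : b m ≤ ‖(1 - circleMap 0 R θ)⁻¹ + y * Complex.I‖ := by
          have h2 : b m + |y| + 1 ≤ ‖(1 - circleMap 0 R θ)⁻¹‖ := by
            rw [norm_inv, le_inv_comm₀ (hden m) (norm_pos_iff.2 h1)]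
            exact hdist
          have h3 := norm_sub_le_norm_add (1 - circleMap 0 R θ)⁻¹ (y * Complex.I)
          have h4 : ‖(y : ℂ) * Complex.I‖ = |y| := by simp
          linarith
        have := Real.log_le_log hpos (hdec m _ (hre _ hnorm) hbig)
        rw [Real.log_mul hKpos.ne' (Real.exp_pos _).ne', Real.log_exp] at this
        have hc : (S.card : ℝ) ≤ m + 1 := by exact_mod_cast hcard
        linarith
  have hsa : Summable a := summable_of_sum_range_le (fun n => (hapos n).le) key
  refine Summable.of_nonneg_of_le (fun n => (inv_pos.2 (hb n)).le) (fun n => ?_)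
    (hsa.mul_left (1 + (|y| + 1) / b 0))
  rw [ha]
  simp only
  rw [← div_eq_mul_inv, le_div_iff₀ (hden n), inv_mul_le_iff₀ (hb n)]
  have h1 : 1 ≤ b n / b 0 := (one_le_div (hb 0)).2 (hbm (Nat.zero_le n))
  have : b n * (1 + (|y| + 1) / b 0) = b n + (|y| + 1) * (b n / b 0) := by ring
  rw [this]
  have := mul_le_mul_of_nonneg_left h1 (by positivity : 0 ≤ |y| + 1)
  linarith

/-! ### Laplace transforms of bounded functions on the half-line -/

/-- The Laplace transform of `g` on the half-line. -/
noncomputable def laplaceHalfLine (g : ℝ → ℝ) (z : ℂ) : ℂ :=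
  ∫ t in Set.Ioi (0 : ℝ), Complex.exp (-z * t) * g t

theorem norm_cexp_neg_mul_ofReal (z : ℂ) (t : ℝ) :
    ‖Complex.exp (-z * t)‖ = Real.exp (-z.re * t) := by
  rw [Complex.norm_exp]; simp

theorem continuous_cexp_neg_mul_mul {g : ℝ → ℝ} (hg : Continuous g) (z : ℂ) :
    Continuous fun t : ℝ => Complex.exp (-z * t) * (g t : ℂ) := by fun_prop

theorem norm_laplace_integrand_le {g : ℝ → ℝ} {A : ℝ} (hA : ∀ t, |g t| ≤ A) (z : ℂ) (t : ℝ) :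
    ‖Complex.exp (-z * t) * (g t : ℂ)‖ ≤ A * Real.exp (-z.re * t) := by
  rw [norm_mul, norm_cexp_neg_mul_ofReal, Complex.norm_real, Real.norm_eq_abs, mul_comm]
  exact mul_le_mul_of_nonneg_right (hA t) (Real.exp_pos _).le

theorem integrableOn_laplace_integrand {g : ℝ → ℝ} (hg : Continuous g) {A : ℝ}
    (hA : ∀ t, |g t| ≤ A) {z : ℂ} (hz : 0 < z.re) :
    IntegrableOn (fun t : ℝ => Complex.exp (-z * t) * (g t : ℂ)) (Set.Ioi 0) :=
  ((exp_neg_integrableOn_Ioi 0 hz).const_mul A).mono'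
    (continuous_cexp_neg_mul_mul hg z).aestronglyMeasurable
    (Filter.Eventually.of_forall fun t => norm_laplace_integrand_le hA z t)

theorem norm_laplaceHalfLine_le {g : ℝ → ℝ} {A : ℝ} (hA : ∀ t, |g t| ≤ A) {z : ℂ}
    (hz : 0 < z.re) : ‖laplaceHalfLine g z‖ ≤ A / z.re := by
  refine (norm_integral_le_of_norm_le ((exp_neg_integrableOn_Ioi 0 hz).const_mul A)
    (Filter.Eventually.of_forall fun t => norm_laplace_integrand_le hA z t)).trans_eq ?_
  rw [integral_const_mul, integral_exp_mul_Ioi (by linarith)]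
  simp [div_eq_mul_inv]

/-- Integration by parts: the boundary term at `0` vanishes by `h0`, the one at infinity by
exponential decay. -/
theorem laplaceHalfLine_deriv {g : ℝ → ℝ} (hg : ContDiff ℝ 1 g) {A A' : ℝ} (hA : ∀ t, |g t| ≤ A)
    (hA' : ∀ t, |deriv g t| ≤ A') (h0 : g 0 = 0) {z : ℂ} (hz : 0 < z.re) :
    laplaceHalfLine (deriv g) z = z * laplaceHalfLine g z := by
  have hi := integrableOn_laplace_integrand hg.continuous hA hz
  have hi' := integrableOn_laplace_integrand (hg.continuous_deriv le_rfl) hA' hz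
  have hd : ∀ t : ℝ, HasDerivAt (fun t : ℝ => Complex.exp (-z * t) * (g t : ℂ))
      (Complex.exp (-z * t) * ((deriv g t : ℝ) : ℂ) - z * (Complex.exp (-z * t) * (g t : ℂ))) t := by
    intro t
    have h1 : HasDerivAt (fun t : ℝ => Complex.exp (-z * t)) (Complex.exp (-z * t) * (-z)) t := by
      have := ((Complex.ofRealCLM.hasDerivAt (x := t)).const_mul (-z)).cexp
      simpa using this
    have h2 := ((hg.differentiable one_ne_zero t).hasDerivAt).ofReal_comp
    refine (h1.mul h2).congr_deriv ?_
    ring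
  have hlim : Filter.Tendsto (fun t : ℝ => Complex.exp (-z * t) * (g t : ℂ)) Filter.atTop
      (nhds 0) := by
    refine squeeze_zero_norm (norm_laplace_integrand_le hA z) ?_
    have := (Real.tendsto_exp_atBot.comp (Filter.tendsto_id.const_mul_atTop_of_neg
      (neg_lt_zero.2 hz))).const_mul A
    simpa using this
  have h := integral_Ioi_of_hasDerivAt_of_tendsto' (a := 0) (fun t _ => hd t)
    (hi'.sub (hi.const_mul z)) hlim
  rw [integral_sub hi' (hi.const_mul z), integral_const_mul] at h
  simp only [h0, Complex.ofReal_zero, mul_zero, sub_zero] at h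
  exact sub_eq_zero.1 h

theorem differentiableOn_laplaceHalfLine {g : ℝ → ℝ} (hg : Continuous g) {A : ℝ}
    (hA : ∀ t, |g t| ≤ A) : DifferentiableOn ℂ (laplaceHalfLine g) {z | 0 < z.re} := by
  intro z hz
  rw [Set.mem_ofPred_eq] at hz
  have hA0 : 0 ≤ A := (abs_nonneg _).trans (hA 0)
  set ε := z.re / 2 with hε
  have hεpos : 0 < ε := by positivity
  have hs : {w : ℂ | ε < w.re} ∈ nhds z :=
    (isOpen_lt continuous_const Complex.continuous_re).mem_nhds (by
      change ε < z.re
      linarith)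
  have := hasDerivAt_integral_of_dominated_loc_of_deriv_le (μ := volume.restrict (Set.Ioi (0 : ℝ)))
    (F := fun (w : ℂ) (t : ℝ) => Complex.exp (-w * t) * (g t : ℂ))
    (F' := fun (w : ℂ) (t : ℝ) => Complex.exp (-w * t) * (-t) * (g t : ℂ))
    (x₀ := z) (bound := fun t => (2 / ε * A) * Real.exp (-(ε / 2) * t)) hs
    (Filter.Eventually.of_forall fun w =>
      (continuous_cexp_neg_mul_mul hg w).aestronglyMeasurable)
    (integrableOn_laplace_integrand hg hA hz)
    (Continuous.aestronglyMeasurable (by fun_prop)) ?_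
    ((exp_neg_integrableOn_Ioi 0 (by positivity)).const_mul _) ?_
  · exact this.2.differentiableAt.differentiableWithinAt
  · filter_upwards [ae_restrict_mem measurableSet_Ioi] with t ht w hw
    rw [Set.mem_Ioi] at ht
    rw [norm_mul, norm_mul, norm_cexp_neg_mul_ofReal, Complex.norm_real, Real.norm_eq_abs,
      norm_neg, Complex.norm_real, Real.norm_of_nonneg ht.le]
    -- Half of the exponential decay is spent on absorbing the factor `t` produced by
    -- differentiating in `w`.
    have h1 : t ≤ 2 / ε * Real.exp (ε / 2 * t) := by
      have h := Real.add_one_le_exp (ε / 2 * t)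
      rw [div_mul_eq_mul_div, le_div_iff₀ hεpos]
      linarith
    have h2 : Real.exp (-w.re * t) ≤ Real.exp (-ε * t) :=
      Real.exp_le_exp.2 (by nlinarith)
    calc Real.exp (-w.re * t) * t * |g t|
        ≤ Real.exp (-ε * t) * (2 / ε * Real.exp (ε / 2 * t)) * A := by
          gcongr
          exact hA t
      _ = 2 / ε * A * (Real.exp (-ε * t) * Real.exp (ε / 2 * t)) := by ring
      _ = 2 / ε * A * Real.exp (-(ε / 2) * t) := by
          rw [← Real.exp_add]; congr 2; ring
  · refine Filter.Eventually.of_forall fun t w _ => ?_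
    have h1 : HasDerivAt (fun w : ℂ => -w * (t : ℂ)) (-(t : ℂ)) w := by
      simpa using ((hasDerivAt_id w).neg.mul_const (t : ℂ))
    exact h1.cexp.mul_const _

-- On the line `re z = 1` the Laplace transform is, up to scaling the frequency, the Fourier
-- transform of `e^{-t} g(t)` cut off to `t > 0`. If it vanished identically, Fourier inversion at
-- the continuity point `x` would give `g x = 0`.
open FourierTransform in
theorem exists_laplaceHalfLine_ne_zero {g : ℝ → ℝ} (hg : Continuous g) {A : ℝ}
    (hA : ∀ t, |g t| ≤ A) {x : ℝ} (hx : 0 < x) (hgx : g x ≠ 0) :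
    ∃ y : ℝ, laplaceHalfLine g (1 + y * Complex.I) ≠ 0 := by
  by_contra! hzero
  set h : ℝ → ℂ := (Set.Ioi 0).indicator fun t : ℝ => Complex.exp (-(1 : ℂ) * t) * (g t : ℂ)
    with hh
  have hint : Integrable h := (integrable_indicator_iff measurableSet_Ioi).2
    (integrableOn_laplace_integrand hg hA (by simp))
  have hF : 𝓕 h = 0 := by
    funext ξ
    have := hzero (2 * Real.pi * ξ)
    rw [Real.fourier_eq', Pi.zero_apply, ← this, laplaceHalfLine,
      ← integral_indicator measurableSet_Ioi]
    congr 1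
    funext t
    by_cases ht : t ∈ Set.Ioi (0 : ℝ)
    · simp only [hh, Set.indicator_of_mem ht, smul_eq_mul]
      rw [← mul_assoc, ← Complex.exp_add]
      congr 2
      simp
      ring
    · simp [hh, Set.indicator_of_notMem ht]
  have hc : ContinuousAt h x := by
    refine ((continuous_cexp_neg_mul_mul hg 1).continuousAt (x := x)).congr ?_
    filter_upwards [Ioi_mem_nhds hx] with t ht
    rw [hh, Set.indicator_of_mem ht]
  have hinv := hint.fourierInv_fourier_eq (by rw [hF]; exact integrable_zero _ _ _) hc
  rw [hF, Real.fourierInv_eq] at hinv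
  simp only [Pi.zero_apply, smul_zero, integral_zero] at hinv
  rw [hh, Set.indicator_of_mem (Set.mem_Ioi.2 hx)] at hinv
  exact mul_ne_zero (Complex.exp_ne_zero _) (Complex.ofReal_ne_zero.2 hgx) hinv.symm

/-! ### Denjoy–Carleman: from a flat function to a convergent series -/

/-- The necessity half of the Denjoy–Carleman theorem: if some nonzero function of the class is
flat at the origin, then `∑ 1 / b n` converges, where `b n` is comparable to
`inf_{k > n} (c k)^{1/k}`. -/
theorem summable_inv_of_flat {c : ℕ → ℝ} (hc : ∀ n, 0 < c n) {f : ℝ → ℝ} (hf : ContDiff ℝ ∞ f)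
    {β B : ℝ} (hβ : 0 < β) (hB : 0 < B)
    (hbd : ∀ (n : ℕ) (x : ℝ), |iteratedDeriv n f x| ≤ β * B ^ n * c n)
    (hflat : ∀ n, iteratedDeriv n f 0 = 0) {x : ℝ} (hx : 0 < x) (hfx : f x ≠ 0)
    {b : ℕ → ℝ} (hb : ∀ n, 0 < b n) (hbm : Monotone b)
    (hbc : ∀ n, ∃ k, n < k ∧ c k ≤ (2 * b n) ^ k) : Summable fun n => (b n)⁻¹ := by
  have hsm : ∀ n, ContDiff ℝ 1 (iteratedDeriv n f) := fun n =>
    iteratedDeriv_eq_iterate (f := f) (n := n) ▸ (hf.iterate_deriv n).of_le (by simp)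
  have hpow : ∀ (n : ℕ) (z : ℂ), 0 < z.re →
      laplaceHalfLine (iteratedDeriv n f) z = z ^ n * laplaceHalfLine f z := by
    intro n z hz
    induction n with
    | zero => simp
    | succ n ih =>
      rw [iteratedDeriv_succ, laplaceHalfLine_deriv (hsm n) (hbd n)
        (by simpa only [iteratedDeriv_succ] using hbd (n + 1)) (hflat n) hz, ih]
      ring
  have hf0 : ∀ t, |f t| ≤ β * c 0 := by simpa using hbd 0
  obtain ⟨y, hy⟩ := exists_laplaceHalfLine_ne_zero hf.continuous hf0 hx hfx
  -- With `D = 2eB` one has `B^k (2 b n)^k = e^{-k} (D b n)^k`, so `‖z‖ ≥ D * b n` yields the factor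
  -- `e^{-k}`, and `k ≥ n + 1`.
  set D : ℝ := 2 * Real.exp 1 * B with hD
  have hDpos : 0 < D := by positivity
  have hs : Summable fun n => (D * b n)⁻¹ := by
    refine summable_inv_of_decay_halfPlane (F := laplaceHalfLine f) (y := y)
      -- One constant for two bounds: `2 β c 0` on the half-plane and `2 β` in front of the decay.
      (K := 2 * β * (c 0 + 1))
      ((differentiableOn_laplaceHalfLine hf.continuous hf0).mono fun z hz => ?_) hy
      (fun n => by have := hb n; positivity) (fun m n h => by have := hbm h; gcongr) ?_ ?_
    · exact lt_trans (by norm_num : (0 : ℝ) < 1 / 2) hz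
    · intro z hz
      refine (norm_laplaceHalfLine_le hf0 (by linarith)).trans ?_
      rw [div_le_iff₀ (by linarith)]
      have := hc 0
      nlinarith [mul_pos hβ this]
    · intro n z hz hzb
      obtain ⟨k, hnk, hck⟩ := hbc n
      have hzpos : 0 < ‖z‖ := lt_of_lt_of_le (mul_pos hDpos (hb n)) hzb
      have h1 := norm_laplaceHalfLine_le (hbd k) (z := z) (by linarith)
      rw [hpow k z (by linarith), norm_mul, norm_pow] at h1
      have h2 : β * B ^ k * c k / z.re ≤ 2 * (β * B ^ k * c k) := by
        rw [div_le_iff₀ (by linarith)]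
        have : 0 < β * B ^ k * c k := by have := hc k; positivity
        nlinarith
      have h3 : 2 * (β * B ^ k * c k) ≤ 2 * β * Real.exp (-k) * ‖z‖ ^ k := by
        calc 2 * (β * B ^ k * c k) ≤ 2 * (β * B ^ k * (2 * b n) ^ k) := by gcongr
          _ = 2 * β * Real.exp (-k) * (D * b n) ^ k := by
            rw [hD, mul_pow, mul_pow, mul_pow, mul_pow, Real.exp_neg, ← Real.exp_one_pow k]
            field_simp
          _ ≤ _ := by
            have := hb n
            gcongr
      have h4 : ‖laplaceHalfLine f z‖ ≤ 2 * β * Real.exp (-k) := by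
        refine le_of_mul_le_mul_left ?_ (pow_pos hzpos k)
        linarith
      refine h4.trans ?_
      have h5 : Real.exp (-k) ≤ Real.exp (-(n + 1)) := by
        apply Real.exp_le_exp.2
        have : ((n + 1 : ℕ) : ℝ) ≤ k := by exact_mod_cast hnk
        push_cast at this
        linarith
      have := hc 0
      have h6 : 2 * β ≤ 2 * β * (c 0 + 1) := by nlinarith
      exact mul_le_mul h6 h5 (Real.exp_pos _).le (by positivity)
  refine (hs.mul_left D).congr fun n => ?_
  rw [mul_inv, mul_inv_cancel_left₀ hDpos.ne']

theorem exists_flat_of_not_isQuasiAnalytic {c : ℕ → ℝ} (hc : ¬ IsQuasiAnalytic c) :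
    ∃ f ∈ carlemanClass c, (∀ n, iteratedDeriv n f 0 = 0) ∧ ∃ x, 0 < x ∧ f x ≠ 0 := by
  simp only [IsQuasiAnalytic, IsQuasiAnalyticClass, not_forall] at hc
  obtain ⟨f, hf, hflat, x, hx⟩ := hc
  rcases lt_trichotomy x 0 with h | h | h
  · obtain ⟨hsm, β, B, hβ, hB, hbd⟩ := hf
    refine ⟨fun t => f (-t), ⟨hsm.comp contDiff_neg, β, B, hβ, hB, fun n t => ?_⟩, fun n => ?_,
      -x, by linarith, by simpa using hx⟩
    · rw [iteratedDeriv_comp_neg, smul_eq_mul, abs_mul, abs_pow, abs_neg, abs_one, one_pow,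
        one_mul]
      exact hbd n _
    · rw [iteratedDeriv_comp_neg, neg_zero, hflat, smul_zero]
  · exact absurd (by simpa [h] using hflat 0) hx
  · exact ⟨f, hf, hflat, x, h, hx⟩

/-- For a non-quasi-analytic increasing sequence `c`, the largest increasing sequence `b` with
`b n ^ (n + 1) ≤ c (n + 1)` has summable inverses. -/
theorem exists_summable_inv_of_not_isQuasiAnalytic {c : ℕ → ℝ} (hc_pos : ∀ n, 0 < c n)
    (hc_mono : Monotone c) (hc : ¬ IsQuasiAnalytic c) :
    ∃ b : ℕ → ℝ, (∀ n, 0 < b n) ∧ Monotone b ∧ (∀ n, b n ^ (n + 1) ≤ c (n + 1)) ∧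
      Summable fun n => (b n)⁻¹ := by
  set r : ℕ → ℝ := fun m => c m ^ ((m : ℝ)⁻¹) with hr
  have hrpos : ∀ m, 0 < r m := fun m => Real.rpow_pos_of_pos (hc_pos m) _
  have hrpow : ∀ m, r (m + 1) ^ (m + 1) = c (m + 1) := fun m =>
    Real.rpow_inv_natCast_pow (hc_pos _).le (Nat.succ_ne_zero m)
  -- This lower bound, which uses that `c` increases, keeps the infima below positive.
  have hrmin : ∀ m, min 1 (c 0) ≤ r (m + 1) := by
    intro m
    have hm : (0 : ℝ) < ((m + 1 : ℕ) : ℝ) := by positivity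
    rcases le_total 1 (c (m + 1)) with h | h
    · exact (min_le_left _ _).trans (Real.one_le_rpow h (by positivity))
    · refine (min_le_right _ _).trans ((hc_mono (Nat.zero_le (m + 1))).trans ?_)
      refine Real.self_le_rpow_of_le_one (hc_pos _).le h (inv_le_one_of_one_le₀ ?_)
      exact_mod_cast Nat.succ_pos m
  set b : ℕ → ℝ := fun n => ⨅ k : ℕ, r (n + k + 1) with hb
  have hbdd : ∀ n, BddBelow (Set.range fun k : ℕ => r (n + k + 1)) := fun n =>
    ⟨min 1 (c 0), by rintro _ ⟨k, rfl⟩; exact hrmin _⟩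
  have hbpos : ∀ n, 0 < b n := fun n =>
    (lt_min one_pos (hc_pos 0)).trans_le (le_ciInf fun k => hrmin _)
  have hbmono : Monotone b := fun m n hmn => le_ciInf fun k => by
    have := ciInf_le (hbdd m) (n - m + k)
    rwa [← add_assoc, Nat.add_sub_cancel' hmn] at this
  obtain ⟨f, ⟨hf, β, B, hβ, hB, hbd⟩, hflat, x, hx, hfx⟩ := exists_flat_of_not_isQuasiAnalytic hc
  refine ⟨b, hbpos, hbmono, fun n => ?_,
    summable_inv_of_flat hc_pos hf hβ hB hbd hflat hx hfx hbpos hbmono fun n => ?_⟩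
  · rw [← hrpow]
    exact pow_le_pow_left₀ (hbpos n).le (ciInf_le (hbdd n) 0) _
  -- The infimum need not be attained; the factor `2` leaves the room to pick an index.
  · obtain ⟨k, hk⟩ := exists_lt_of_ciInf_lt (show b n < 2 * b n by linarith [hbpos n])
    refine ⟨n + k + 1, by omega, ?_⟩
    rw [← hrpow]
    exact pow_le_pow_left₀ (hrpos _).le hk.le _

/-! ### Denjoy–Carleman: mollifiers from iterated averages -/

/-- The limit is a telescoping series, and the summable bounds allow termwise differentiation to
every order. -/
theorem exists_contDiff_tendsto_iteratedDeriv {u : ℕ → ℝ → ℝ} (hu : ∀ m, ContDiff ℝ ∞ (u m))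
    {v : ℕ → ℕ → ℝ} (hv : ∀ n, Summable (v n))
    (hle : ∀ n m x, |iteratedDeriv n (u (m + 1)) x - iteratedDeriv n (u m) x| ≤ v n m) :
    ∃ φ : ℝ → ℝ, ContDiff ℝ ∞ φ ∧ ∀ n x,
      Filter.Tendsto (fun m => iteratedDeriv n (u m) x) Filter.atTop
        (nhds (iteratedDeriv n φ x)) := by
  set w : ℕ → ℝ → ℝ := fun m => u (m + 1) - u m with hw
  have hwc : ∀ m, ContDiff ℝ ((⊤ : ℕ∞) : WithTop ℕ∞) (w m) := fun m => (hu (m + 1)).sub (hu m)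
  have hwd : ∀ n m x, iteratedDeriv n (w m) x =
      iteratedDeriv n (u (m + 1)) x - iteratedDeriv n (u m) x := fun n m x =>
    iteratedDeriv_sub ((hu (m + 1)).contDiffAt.of_le (by exact_mod_cast le_top))
      ((hu m).contDiffAt.of_le (by exact_mod_cast le_top))
  have hwle : ∀ (n m : ℕ) (x : ℝ), (n : ℕ∞) ≤ ⊤ → ‖iteratedFDeriv ℝ n (w m) x‖ ≤ v n m := by
    intro n m x _
    rw [norm_iteratedFDeriv_eq_norm_iteratedDeriv, hwd]
    exact hle n m x
  have hsm : ContDiff ℝ ∞ fun x => ∑' m, w m x := contDiff_tsum hwc (fun n _ => hv n) hwle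
  refine ⟨fun x => u 0 x + ∑' m, w m x, (hu 0).add hsm, fun n x => ?_⟩
  have hφ : iteratedDeriv n (fun x => u 0 x + ∑' m, w m x) x =
      iteratedDeriv n (u 0) x + ∑' m, iteratedDeriv n (w m) x := by
    have h1 := iteratedDeriv_add (n := n) (x := x)
      ((hu 0).contDiffAt.of_le (by exact_mod_cast le_top))
      (hsm.contDiffAt.of_le (by exact_mod_cast le_top))
    refine h1.trans ?_
    congr 1
    have hs : Summable fun m => iteratedFDeriv ℝ n (w m) x :=
      Summable.of_norm_bounded (hv n) fun m => hwle n m x le_top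
    rw [iteratedDeriv, iteratedFDeriv_tsum_apply hwc (fun n _ => hv n) hwle le_top]
    exact (ContinuousMultilinearMap.apply ℝ (fun _ : Fin n => ℝ) ℝ (fun _ => 1)).map_tsum hs
  have hs : Summable fun m => iteratedDeriv n (w m) x :=
    Summable.of_norm_bounded (hv n) fun m => by rw [hwd]; exact hle n m x
  rw [hφ]
  refine (hs.hasSum.tendsto_sum_nat.const_add (iteratedDeriv n (u 0) x)).congr fun M => ?_
  simp only [hwd, Finset.sum_range_sub (fun m => iteratedDeriv n (u m) x)]
  ring

/-- The average of `u` over `[x - a, x + a]`. -/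
noncomputable def boxAverage (a : ℝ) (u : ℝ → ℝ) (x : ℝ) : ℝ :=
  (2 * a)⁻¹ * ∫ t in (x - a)..(x + a), u t

section boxAverage

variable {a : ℝ} {u : ℝ → ℝ}

theorem hasDerivAt_boxAverage (hu : Continuous u) (x : ℝ) :
    HasDerivAt (boxAverage a u) ((2 * a)⁻¹ * (u (x + a) - u (x - a))) x := by
  have h : ∀ y, HasDerivAt (fun s => ∫ t in (0 : ℝ)..s, u t) (u y) y := fun y =>
    intervalIntegral.integral_hasDerivAt_right (hu.intervalIntegrable _ _)
      (hu.stronglyMeasurableAtFilter _ _) hu.continuousAt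
  have h1 := (h (x + a)).comp_add_const x a
  have h2 := (h (x - a)).comp_sub_const x a
  refine ((h1.sub h2).const_mul (2 * a)⁻¹).congr_of_eventuallyEq
    (Filter.Eventually.of_forall fun y => ?_)
  simp only [boxAverage, Pi.sub_apply]
  rw [intervalIntegral.integral_interval_sub_left (hu.intervalIntegrable _ _)
    (hu.intervalIntegrable _ _)]

theorem deriv_boxAverage (hu : ContDiff ℝ 1 u) :
    deriv (boxAverage a u) = boxAverage a (deriv u) := by
  funext x
  rw [(hasDerivAt_boxAverage hu.continuous x).deriv, boxAverage,
    intervalIntegral.integral_deriv_eq_sub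
      (fun y _ => hu.differentiable one_ne_zero y)
      ((hu.continuous_deriv le_rfl).intervalIntegrable _ _)]

theorem contDiff_boxAverage (hu : ContDiff ℝ ∞ u) : ContDiff ℝ ∞ (boxAverage a u) := by
  refine contDiff_infty_iff_deriv.2
    ⟨fun x => (hasDerivAt_boxAverage hu.continuous x).differentiableAt, ?_⟩
  rw [show deriv (boxAverage a u) = fun x => (2 * a)⁻¹ * (u (x + a) - u (x - a)) from
    funext fun x => (hasDerivAt_boxAverage hu.continuous x).deriv]
  exact contDiff_const.mul ((hu.comp (contDiff_id.add contDiff_const)).sub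
    (hu.comp (contDiff_id.sub contDiff_const)))

theorem contDiff_iteratedDeriv (hu : ContDiff ℝ ∞ u) (n : ℕ) :
    ContDiff ℝ ∞ (iteratedDeriv n u) :=
  iteratedDeriv_eq_iterate (f := u) (n := n) ▸ hu.iterate_deriv n

theorem iteratedDeriv_boxAverage (hu : ContDiff ℝ ∞ u) (n : ℕ) :
    iteratedDeriv n (boxAverage a u) = boxAverage a (iteratedDeriv n u) := by
  induction n with
  | zero => simp
  | succ n ih =>
    rw [iteratedDeriv_succ, ih, deriv_boxAverage ((contDiff_iteratedDeriv hu n).of_le (by simp)),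
      ← iteratedDeriv_succ]

/-- An average stays in any interval containing the averaged values. The choices `y = 0` and `y = u
x` give the sup bound, the support estimate and the distance to `u`. -/
theorem abs_boxAverage_sub_le (ha : 0 < a) (hu : Continuous u) {A y : ℝ} (x : ℝ)
    (h : ∀ t ∈ Set.Icc (x - a) (x + a), |u t - y| ≤ A) : |boxAverage a u x - y| ≤ A := by
  have h1 : boxAverage a u x - y = (2 * a)⁻¹ * ∫ t in (x - a)..(x + a), (u t - y) := by
    rw [intervalIntegral.integral_sub (hu.intervalIntegrable _ _) intervalIntegrable_const,
      intervalIntegral.integral_const, boxAverage, smul_eq_mul]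
    field_simp
    ring
  have h2 : ‖∫ t in (x - a)..(x + a), (u t - y)‖ ≤ A * |x + a - (x - a)| := by
    refine intervalIntegral.norm_integral_le_of_norm_le_const fun t ht => ?_
    rw [Set.uIoc_of_le (by linarith)] at ht
    exact h t ⟨ht.1.le, ht.2⟩
  rw [h1, abs_mul, abs_of_pos (by positivity : 0 < (2 * a)⁻¹), inv_mul_le_iff₀ (by positivity)]
  rw [show x + a - (x - a) = 2 * a by ring, abs_of_pos (by positivity), Real.norm_eq_abs] at h2
  linarith

theorem abs_boxAverage_le (ha : 0 < a) (hu : Continuous u) {A : ℝ} (h : ∀ t, |u t| ≤ A) (x : ℝ) :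
    |boxAverage a u x| ≤ A := by
  simpa using abs_boxAverage_sub_le (y := 0) ha hu x (fun t _ => by simpa using h t)

theorem boxAverage_nonneg (ha : 0 < a) (h : ∀ t, 0 ≤ u t) (x : ℝ) : 0 ≤ boxAverage a u x :=
  mul_nonneg (by positivity)
    (intervalIntegral.integral_nonneg (by linarith) fun t _ => h t)

theorem boxAverage_eq_zero (ha : 0 < a) (hu : Continuous u) {r : ℝ}
    (h : ∀ t, r < |t| → u t = 0) (x : ℝ) (hx : r + a < |x|) : boxAverage a u x = 0 := by
  have := abs_boxAverage_sub_le (y := 0) (A := 0) ha hu x fun t ht => by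
    rw [h t, sub_zero, abs_zero]
    have h1 : |x - t| ≤ a := abs_le.2 ⟨by linarith [ht.2], by linarith [ht.1]⟩
    have h2 := abs_sub_abs_le_abs_sub x t
    linarith
  simpa using this

theorem abs_boxAverage_sub_self_le (ha : 0 < a) (hu : ContDiff ℝ 1 u) {A : ℝ}
    (h : ∀ t, |deriv u t| ≤ A) (x : ℝ) : |boxAverage a u x - u x| ≤ a * A := by
  refine abs_boxAverage_sub_le ha hu.continuous x fun t ht => ?_
  have h1 := Convex.norm_image_sub_le_of_norm_deriv_le (f := u) (C := A) (s := Set.univ)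
    (fun y _ => hu.differentiable one_ne_zero y) (fun y _ => h y) convex_univ
    (Set.mem_univ x) (Set.mem_univ t)
  refine h1.trans ?_
  rw [mul_comm]
  refine mul_le_mul_of_nonneg_right ?_ ((abs_nonneg _).trans (h 0))
  rw [Real.norm_eq_abs]
  exact abs_le.2 ⟨by linarith [ht.1], by linarith [ht.2]⟩

/-- The derivative of an average is a symmetric difference quotient, so one extra derivative costs
only a factor `a⁻¹`. -/
theorem abs_iteratedDeriv_succ_boxAverage_le (ha : 0 < a) (hu : ContDiff ℝ ∞ u) {n : ℕ} {A : ℝ}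
    (h : ∀ t, |iteratedDeriv n u t| ≤ A) (x : ℝ) :
    |iteratedDeriv (n + 1) (boxAverage a u) x| ≤ A * a⁻¹ := by
  rw [iteratedDeriv_succ, iteratedDeriv_boxAverage hu,
    (hasDerivAt_boxAverage (contDiff_iteratedDeriv hu n).continuous x).deriv, abs_mul,
    abs_of_pos (by positivity : 0 < (2 * a)⁻¹)]
  have h1 := (abs_sub _ _).trans (add_le_add (h (x + a)) (h (x - a)))
  calc (2 * a)⁻¹ * |iteratedDeriv n u (x + a) - iteratedDeriv n u (x - a)|
      ≤ (2 * a)⁻¹ * (A + A) := by gcongr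
    _ = A * a⁻¹ := by field_simp; ring

end boxAverage

/-- A smooth function `u₀` is smoothed by averaging successively over intervals of half-length
`a 0, a 1, …`. -/
theorem exists_iterated_boxAverage {a : ℕ → ℝ} (ha : ∀ m, 0 < a m) {s : ℝ} (hs : HasSum a s)
    {u₀ : ℝ → ℝ} (hu₀ : ContDiff ℝ ∞ u₀) (hnn : ∀ x, 0 ≤ u₀ x) {r : ℝ}
    (hsupp : ∀ x, r < |x| → u₀ x = 0) {A : ℕ → ℝ}
    (hA : ∀ n x, |iteratedDeriv n u₀ x| ≤ A n) :
    ∃ φ : ℝ → ℝ, ContDiff ℝ ∞ φ ∧ (∀ x, 0 ≤ φ x) ∧ (∀ x, r + s < |x| → φ x = 0) ∧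
      (∀ n x, |iteratedDeriv n φ x| ≤ A 0 * ∏ j ∈ Finset.range n, (a j)⁻¹) ∧
      ∀ x, u₀ x - s * A 1 ≤ φ x := by
  set u : ℕ → ℝ → ℝ := fun m => Nat.rec u₀ (fun m v => boxAverage (a m) v) m with hu
  have hzero : u 0 = u₀ := rfl
  have hsucc : ∀ m, u (m + 1) = boxAverage (a m) (u m) := fun m => rfl
  have hc : ∀ m, ContDiff ℝ ∞ (u m) := by
    intro m
    induction m with
    | zero => exact hu₀
    | succ m ih => rw [hsucc]; exact contDiff_boxAverage ih
  have hcn : ∀ n m, ContDiff ℝ ∞ (iteratedDeriv n (u m)) := fun n m =>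
    contDiff_iteratedDeriv (hc m) n
  have hbd : ∀ n m x, |iteratedDeriv n (u m) x| ≤ A n := by
    intro n m
    induction m with
    | zero => exact hA n
    | succ m ih =>
      rw [hsucc, iteratedDeriv_boxAverage (hc m)]
      exact abs_boxAverage_le (ha m) (hcn n m).continuous ih
  -- The `n`-th derivative is charged to the first `n` averages; later ones do not increase the
  -- bound. The diagonal case `n = m + 1` is where a new factor enters.
  have hbd' : ∀ m n, n ≤ m → ∀ x,
      |iteratedDeriv n (u m) x| ≤ A 0 * ∏ j ∈ Finset.range n, (a j)⁻¹ := by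
    intro m
    induction m with
    | zero =>
      intro n hn x
      obtain rfl : n = 0 := by omega
      simpa [hzero] using hA 0 x
    | succ m ih =>
      intro n hn x
      rw [hsucc]
      rcases Nat.lt_or_ge m n with h | h
      · obtain rfl : n = m + 1 := by omega
        rw [Finset.prod_range_succ, ← mul_assoc]
        exact abs_iteratedDeriv_succ_boxAverage_le (ha m) (hc m) (ih m le_rfl) x
      · rw [iteratedDeriv_boxAverage (hc m)]
        exact abs_boxAverage_le (ha m) (hcn n m).continuous (ih n h) x
  have hdiff : ∀ n m x, |iteratedDeriv n (u (m + 1)) x - iteratedDeriv n (u m) x|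
      ≤ a m * A (n + 1) := by
    intro n m x
    rw [hsucc, iteratedDeriv_boxAverage (hc m)]
    refine abs_boxAverage_sub_self_le (ha m) ((hcn n m).of_le (by simp)) (fun t => ?_) x
    rw [← iteratedDeriv_succ]
    exact hbd (n + 1) m t
  have hsle : ∀ m, ∑ j ∈ Finset.range m, a j ≤ s := fun m =>
    sum_le_hasSum _ (fun j _ => (ha j).le) hs
  obtain ⟨φ, hφ, hlim⟩ := exists_contDiff_tendsto_iteratedDeriv hc
    (fun n => hs.summable.mul_right (A (n + 1))) hdiff
  have hlim0 : ∀ x, Filter.Tendsto (fun m => u m x) Filter.atTop (nhds (φ x)) := by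
    simpa using hlim 0
  refine ⟨φ, hφ, fun x => ?_, fun x hx => ?_, fun n x => ?_, fun x => ?_⟩
  · refine ge_of_tendsto' (hlim0 x) fun m => ?_
    have : ∀ x, 0 ≤ u m x := by
      induction m with
      | zero => exact hnn
      | succ m ih => rw [hsucc]; exact boxAverage_nonneg (ha m) ih
    exact this x
  · have h0 : ∀ m x, r + ∑ j ∈ Finset.range m, a j < |x| → u m x = 0 := by
      intro m
      induction m with
      | zero => simpa [hzero] using hsupp
      | succ m ih =>
        intro x hx
        rw [hsucc]
        refine boxAverage_eq_zero (ha m) (hc m).continuous ih x ?_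
        rwa [Finset.sum_range_succ, ← add_assoc] at hx
    refine tendsto_nhds_unique (hlim0 x) (tendsto_const_nhds.congr fun m => ?_)
    exact (h0 m x (by linarith [hsle m])).symm
  · exact le_of_tendsto (hlim n x).abs
      ((Filter.eventually_ge_atTop n).mono fun m hm => hbd' m n hm x)
  · refine ge_of_tendsto' (hlim0 x) fun m => ?_
    have h1 : u₀ x - (∑ j ∈ Finset.range m, a j) * A 1 ≤ u m x := by
      induction m with
      | zero => simp [hzero]
      | succ m ih =>
        have := (abs_le.1 (by simpa using hdiff 0 m x)).1
        rw [Finset.sum_range_succ]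
        linarith
    have h2 : 0 ≤ A 1 := (abs_nonneg _).trans (hA 1 0)
    have := mul_le_mul_of_nonneg_right (hsle m) h2
    linarith

/-- Shrinking finitely many terms makes the sum of a convergent positive series small, at the cost
of a constant factor in the products of inverses. -/
theorem exists_hasSum_le_prod_inv_le {e : ℕ → ℝ} (he : ∀ j, 0 < e j) (hs : Summable e) {t : ℝ}
    (ht : 0 < t) : ∃ (a : ℕ → ℝ) (s C : ℝ), (∀ j, 0 < a j) ∧ HasSum a s ∧ s ≤ t ∧ 0 < C ∧
      ∀ n, ∏ j ∈ Finset.range n, (a j)⁻¹ ≤ C * ∏ j ∈ Finset.range n, (e j)⁻¹ := by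
  obtain ⟨N, hN⟩ := ((tendsto_sum_nat_add e).eventually_lt_const (half_pos ht)).exists
  set S := ∑ j ∈ Finset.range N, e j with hS
  have hS0 : 0 ≤ S := Finset.sum_nonneg fun j _ => (he j).le
  -- The first `N` terms are scaled by `δ` so that they sum to at most `t / 2`, like the untouched
  -- tail; the inverse products then grow by at most `δ⁻¹ ^ N`.
  set δ : ℝ := min 1 (t / 2 / (S + 1)) with hδ
  have hδ0 : 0 < δ := lt_min one_pos (by positivity)
  have hδ1 : δ ≤ 1 := min_le_left _ _
  have hδS : δ * S ≤ t / 2 := by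
    have h1 : δ * (S + 1) ≤ t / 2 := (le_div_iff₀ (by positivity)).1 (min_le_right _ _)
    nlinarith
  set l : ℕ → ℝ := fun j => if j < N then δ else 1 with hl
  have hl0 : ∀ j, 0 < l j := fun j => by simp only [hl]; split_ifs <;> positivity
  have hl1 : ∀ j, l j ≤ 1 := fun j => by simp only [hl]; split_ifs <;> simp [hδ1]
  have hsum : Summable fun j => l j * e j :=
    Summable.of_nonneg_of_le (fun j => (mul_pos (hl0 j) (he j)).le)
      (fun j => mul_le_of_le_one_left (he j).le (hl1 j)) hs
  refine ⟨fun j => l j * e j, _, δ⁻¹ ^ N, fun j => mul_pos (hl0 j) (he j), hsum.hasSum, ?_,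
    by positivity, fun n => ?_⟩
  · rw [← hsum.sum_add_tsum_nat_add N]
    have h1 : ∑ j ∈ Finset.range N, l j * e j = δ * S := by
      rw [hS, Finset.mul_sum]
      refine Finset.sum_congr rfl fun j hj => ?_
      simp [hl, Finset.mem_range.1 hj]
    have h2 : ∑' j, l (j + N) * e (j + N) = ∑' j, e (j + N) :=
      tsum_congr fun j => by simp [hl]
    rw [h1, h2]
    linarith
  · simp only [mul_inv, Finset.prod_mul_distrib]
    refine mul_le_mul_of_nonneg_right ?_
      (Finset.prod_nonneg fun j _ => (inv_pos.2 (he j)).le)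
    have h1 : ∏ j ∈ Finset.range n, (l j)⁻¹ =
        δ⁻¹ ^ ((Finset.range n).filter (· < N)).card := by
      simp only [hl, apply_ite, inv_one]
      rw [Finset.prod_ite, Finset.prod_const, Finset.prod_const_one, mul_one]
    rw [h1]
    refine pow_le_pow_right₀ ((one_le_inv₀ hδ0).2 hδ1) ?_
    have : (Finset.range n).filter (· < N) ⊆ Finset.range N := fun j hj =>
      Finset.mem_range.2 (Finset.mem_filter.1 hj).2
    simpa using Finset.card_le_card this

/-- The sufficiency half of the Denjoy–Carleman theorem: nonnegative test functions of integral
one and arbitrarily small support in a non-quasi-analytic class. -/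
theorem exists_mollifier_of_not_isQuasiAnalytic {c : ℕ → ℝ} (hc_pos : ∀ n, 0 < c n)
    (hc_mono : Monotone c) (hc : ¬ IsQuasiAnalytic c) {ε : ℝ} (hε : 0 < ε) :
    ∃ (φ : ℝ → ℝ) (C : ℝ), ContDiff ℝ ∞ φ ∧ (∀ x, 0 ≤ φ x) ∧ (∀ x, ε < |x| → φ x = 0) ∧
      ∫ x, φ x = 1 ∧ 0 < C ∧ ∀ n x, |iteratedDeriv n φ x| ≤ C * ((1 / 2) ^ n * c n) := by
  obtain ⟨b, hb0, hbm, hbc, hbs⟩ := exists_summable_inv_of_not_isQuasiAnalytic hc_pos hc_mono hc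
  let g : ContDiffBump (0 : ℝ) := ⟨ε / 4, ε / 2, by positivity, by linarith⟩
  have hgc : ContDiff ℝ ∞ g := g.contDiff
  have hgA : ∀ n, ∃ A, ∀ x, |iteratedDeriv n g x| ≤ A := fun n => by
    obtain ⟨A, hA⟩ := (g.hasCompactSupport.iteratedFDeriv (𝕜 := ℝ) n).exists_bound_of_continuous
      (hgc.continuous_iteratedFDeriv (by exact_mod_cast le_top))
    refine ⟨A, fun x => ?_⟩
    rw [← Real.norm_eq_abs, ← norm_iteratedFDeriv_eq_norm_iteratedDeriv]
    exact hA x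
  choose A hA using hgA
  have hA1 : 0 ≤ A 1 := (abs_nonneg _).trans (hA 1 0)
  have hA0 : 0 ≤ A 0 := (abs_nonneg _).trans (hA 0 0)
  -- The factor `2` in the half-lengths produces the `(1 / 2) ^ n` of the conclusion. The bound `s ≤
  -- ε / 2` controls the support, and `s ≤ (2 (A 1 + 1))⁻¹` keeps the limit nonzero at `0`.
  obtain ⟨a, s, C, ha, hs, hst, hC, hprod⟩ := exists_hasSum_le_prod_inv_le
    (fun j => mul_pos two_pos (inv_pos.2 (hb0 j))) (hbs.mul_left 2)
    (lt_min (half_pos hε) (by positivity : 0 < (2 * (A 1 + 1))⁻¹))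
  obtain ⟨φ, hφ, hnn, hsupp, hbd, hlow⟩ := exists_iterated_boxAverage ha hs g.contDiff
    (fun x => g.nonneg) (r := ε / 2) (fun x hx => g.zero_of_le_dist (by simpa using hx.le)) hA
  have hφ0 : φ 0 ≠ 0 := by
    have h1 : (g : ℝ → ℝ) 0 = 1 := g.one_of_mem_closedBall (by simpa using g.rIn_pos.le)
    have h2 := hlow 0
    have h3 : s * (2 * (A 1 + 1)) ≤ 1 := by
      have := hst.trans (min_le_right _ _)
      rwa [← one_div, le_div_iff₀ (by positivity)] at this
    have h4 : 0 ≤ s := hs.nonneg fun j => (ha j).le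
    rw [h1] at h2
    nlinarith
  have hsupp' : ∀ x, ε < |x| → φ x = 0 := fun x hx => hsupp x (by
    have := hst.trans (min_le_left _ _)
    linarith)
  have hcs : HasCompactSupport φ := HasCompactSupport.intro (isCompact_closedBall (0 : ℝ) ε)
    fun x hx => hsupp' x (by simpa using hx)
  have hI : 0 < ∫ x, φ x :=
    hφ.continuous.integral_pos_of_hasCompactSupport_nonneg_nonzero hcs hnn hφ0
  set I := ∫ x, φ x with hIdef
  -- The constant `1 + (c 0)⁻¹` is there for `n = 0`, where the empty product `1` must be compared
  -- with `c 0`.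
  have hprod2 : ∀ n, ∏ j ∈ Finset.range n, (2 * (b j)⁻¹)⁻¹ ≤ (1 + (c 0)⁻¹) * ((1 / 2) ^ n * c n) := by
    intro n
    have h1 : ∏ j ∈ Finset.range n, (2 * (b j)⁻¹)⁻¹ =
        (1 / 2) ^ n * ∏ j ∈ Finset.range n, b j := by
      simp only [mul_inv, inv_inv, Finset.prod_mul_distrib, Finset.prod_const, Finset.card_range,
        one_div]
    have hc0 := inv_pos.2 (hc_pos 0)
    have h2 : ∏ j ∈ Finset.range n, b j ≤ (1 + (c 0)⁻¹) * c n := by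
      cases n with
      | zero =>
        have := hc_pos 0
        rw [Finset.prod_range_zero, add_mul, inv_mul_cancel₀ this.ne']
        linarith
      | succ n =>
        have h3 : ∏ j ∈ Finset.range (n + 1), b j ≤ b n ^ (n + 1) := by
          refine (Finset.prod_le_prod (fun j _ => (hb0 j).le) fun j hj =>
            hbm (Nat.lt_succ_iff.1 (Finset.mem_range.1 hj))).trans_eq ?_
          simp
        have := hc_pos (n + 1)
        refine (h3.trans (hbc n)).trans ?_
        nlinarith
    rw [h1]
    calc (1 / 2 : ℝ) ^ n * ∏ j ∈ Finset.range n, b j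
        ≤ (1 / 2 : ℝ) ^ n * ((1 + (c 0)⁻¹) * c n) := by gcongr
      _ = _ := by ring
  have hc0 := inv_pos.2 (hc_pos 0)
  refine ⟨fun x => I⁻¹ * φ x, I⁻¹ * ((A 0 + 1) * (C * (1 + (c 0)⁻¹))), contDiff_const.mul hφ,
    fun x => mul_nonneg (inv_pos.2 hI).le (hnn x), fun x hx => by simp [hsupp' x hx], ?_,
    by positivity, fun n x => ?_⟩
  · rw [integral_const_mul, inv_mul_cancel₀ hI.ne']
  · rw [iteratedDeriv_const_mul_field, abs_mul, abs_of_pos (inv_pos.2 hI), mul_assoc]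
    refine mul_le_mul_of_nonneg_left ((hbd n x).trans ?_) (inv_pos.2 hI).le
    have hP : 0 ≤ ∏ j ∈ Finset.range n, (a j)⁻¹ :=
      Finset.prod_nonneg fun j _ => (inv_pos.2 (ha j)).le
    calc A 0 * ∏ j ∈ Finset.range n, (a j)⁻¹
        ≤ (A 0 + 1) * (C * ((1 + (c 0)⁻¹) * ((1 / 2) ^ n * c n))) := by
          refine mul_le_mul (by linarith) ((hprod n).trans ?_) hP (by linarith)
          exact mul_le_mul_of_nonneg_left (hprod2 n) hC.le
      _ = _ := by ring

/-! ### Product kernels and convolution in several variables -/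

section multiD

variable {d : ℕ}

theorem partialD_eq_zero_of_isOpen {U : Set (EuclideanSpace ℝ (Fin d))} (hU : IsOpen U)
    (i : Fin d) {f : EuclideanSpace ℝ (Fin d) → ℝ} (h : ∀ x ∈ U, f x = 0) :
    ∀ x ∈ U, partialD i f x = 0 := by
  intro x hx
  have : f =ᶠ[nhds x] fun _ => 0 := Filter.mem_of_superset (hU.mem_nhds hx) h
  simp [partialD, this.fderiv_eq]

theorem multiD_eq_zero_of_isOpen {U : Set (EuclideanSpace ℝ (Fin d))} (hU : IsOpen U)
    (β : Fin d → ℕ) {f : EuclideanSpace ℝ (Fin d) → ℝ} (h : ∀ x ∈ U, f x = 0) :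
    ∀ x ∈ U, multiD β f x = 0 := by
  unfold multiD
  induction List.finRange d with
  | nil => exact h
  | cons i l ih =>
    rw [List.foldr_cons]
    induction β i with
    | zero => exact ih
    | succ n ihn =>
      rw [Function.iterate_succ_apply']
      exact partialD_eq_zero_of_isOpen hU i ihn

theorem multiD_eq_zero_of_lt_norm {R : ℝ} (β : Fin d → ℕ) {f : EuclideanSpace ℝ (Fin d) → ℝ}
    (h : ∀ x, R < ‖x‖ → f x = 0) (x : EuclideanSpace ℝ (Fin d)) (hx : R < ‖x‖) :
    multiD β f x = 0 :=
  multiD_eq_zero_of_isOpen (U := {x | R < ‖x‖}) (isOpen_lt continuous_const continuous_norm) β h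
    x hx

/-- The product function `x ↦ ∏ i, h i (x i)`. -/
noncomputable def tensorFun (h : Fin d → ℝ → ℝ) (x : EuclideanSpace ℝ (Fin d)) : ℝ :=
  ∏ i, h i (x i)

theorem contDiff_tensorFun {h : Fin d → ℝ → ℝ} (hh : ∀ i, ContDiff ℝ ∞ (h i)) :
    ContDiff ℝ ∞ (tensorFun h) :=
  contDiff_prod fun i _ => (hh i).comp (EuclideanSpace.proj (𝕜 := ℝ) i).contDiff

theorem partialD_tensorFun {h : Fin d → ℝ → ℝ} (hh : ∀ i, ContDiff ℝ ∞ (h i)) (i : Fin d) :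
    partialD i (tensorFun h) = tensorFun (Function.update h i (deriv (h i))) := by
  funext x
  rw [partialD, ← DifferentiableAt.lineDeriv_eq_fderiv
    ((contDiff_tensorFun hh).differentiable (by simp) x), lineDeriv]
  have h1 : (fun t : ℝ => tensorFun h (x + t • EuclideanSpace.single i 1)) =
      fun t => h i (t + x i) * ∏ j ∈ Finset.univ.erase i, h j (x j) := by
    funext t
    rw [tensorFun, ← Finset.mul_prod_erase _ _ (Finset.mem_univ i)]
    congr 1
    · simp [add_comm]
    · refine Finset.prod_congr rfl fun j hj => ?_
      simp [Finset.ne_of_mem_erase hj]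
  have h2 : HasDerivAt (fun t => h i (t + x i)) (deriv (h i) (x i)) 0 := by
    have h3 : HasDerivAt (h i) (deriv (h i) (0 + x i)) (0 + x i) :=
      ((hh i).differentiable (by simp) _).hasDerivAt
    simpa using h3.comp_add_const 0 (x i)
  rw [h1, (h2.mul_const _).deriv, tensorFun, ← Finset.mul_prod_erase _ _ (Finset.mem_univ i)]
  congr 1
  · simp
  · refine Finset.prod_congr rfl fun j hj => ?_
    simp [Finset.ne_of_mem_erase hj]

theorem iterate_partialD_tensorFun {h : Fin d → ℝ → ℝ} (hh : ∀ i, ContDiff ℝ ∞ (h i))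
    (i : Fin d) (n : ℕ) : (partialD i)^[n] (tensorFun h) =
      tensorFun (Function.update h i (iteratedDeriv n (h i))) := by
  induction n with
  | zero => simp
  | succ n ih =>
    rw [Function.iterate_succ_apply', ih, partialD_tensorFun]
    · simp [iteratedDeriv_succ]
    · intro j
      rcases eq_or_ne j i with rfl | hj
      · simpa using contDiff_iteratedDeriv (hh j) n
      · simpa [hj] using hh j

theorem multiD_tensorFun {h : Fin d → ℝ → ℝ} (hh : ∀ i, ContDiff ℝ ∞ (h i)) (β : Fin d → ℕ) :
    multiD β (tensorFun h) = tensorFun fun i => iteratedDeriv (β i) (h i) := by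
  have key : ∀ l : List (Fin d), l.Nodup →
      l.foldr (fun i g => (partialD i)^[β i] g) (tensorFun h) =
        tensorFun fun j => if j ∈ l then iteratedDeriv (β j) (h j) else h j := by
    intro l hl
    induction l with
    | nil => simp
    | cons i l ih =>
      obtain ⟨hi, hl'⟩ := List.nodup_cons.1 hl
      rw [List.foldr_cons, ih hl', iterate_partialD_tensorFun]
      · congr 1
        funext j
        rcases eq_or_ne j i with rfl | hj
        · simp [hi]
        · simp [hj]
      · intro j
        split_ifs
        · exact contDiff_iteratedDeriv (hh j) _
        · exact hh j
  rw [multiD, key _ (List.nodup_finRange d)]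
  simp

theorem norm_le_of_abs_apply_le {x : EuclideanSpace ℝ (Fin d)} {ε : ℝ} (hε : 0 ≤ ε)
    (hx : ∀ i, |x i| ≤ ε) : ‖x‖ ≤ (d + 1) * ε := by
  rw [EuclideanSpace.norm_eq]
  refine Real.sqrt_le_iff.2 ⟨by positivity, ?_⟩
  have h1 : ∑ i, ‖x i‖ ^ 2 ≤ ∑ _i : Fin d, ε ^ 2 :=
    Finset.sum_le_sum fun i _ => pow_le_pow_left₀ (norm_nonneg _) (hx i) 2
  refine h1.trans ?_
  rw [Finset.sum_const, Finset.card_univ, Fintype.card_fin, nsmul_eq_mul, mul_pow]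
  refine mul_le_mul_of_nonneg_right ?_ (sq_nonneg ε)
  have : (0 : ℝ) ≤ d := Nat.cast_nonneg d
  nlinarith

theorem integral_tensorFun (h : Fin d → ℝ → ℝ) : ∫ x, tensorFun h x = ∏ i, ∫ t, h i t := by
  rw [← integral_fintype_prod_volume_eq_prod]
  exact (PiLp.volume_preserving_ofLp (Fin d)).integral_comp
    (MeasurableEquiv.toLp 2 (Fin d → ℝ)).symm.measurableEmbedding fun x => ∏ i, h i (x i)

open scoped Convolution

theorem partialD_convolution_right (i : Fin d) {f g : EuclideanSpace ℝ (Fin d) → ℝ}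
    (hf : Continuous f) (hg : ContDiff ℝ ∞ g) (hgc : HasCompactSupport g) :
    partialD i (f ⋆[ContinuousLinearMap.lsmul ℝ ℝ] g) =
      f ⋆[ContinuousLinearMap.lsmul ℝ ℝ] partialD i g := by
  funext x
  rw [partialD, (hgc.hasFDerivAt_convolution_right _ hf.locallyIntegrable
    (hg.of_le (by simp)) x).fderiv, convolution_precompR_apply _ hf.locallyIntegrable
      (hgc.fderiv ℝ) (hg.continuous_fderiv (by simp))]
  rfl

theorem multiD_convolution_right (β : Fin d → ℕ) {f g : EuclideanSpace ℝ (Fin d) → ℝ}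
    (hf : Continuous f) (hg : ContDiff ℝ ∞ g) (hgc : HasCompactSupport g) :
    multiD β (f ⋆[ContinuousLinearMap.lsmul ℝ ℝ] g) =
      f ⋆[ContinuousLinearMap.lsmul ℝ ℝ] multiD β g := by
  have iter : ∀ (i : Fin d) (n : ℕ) {g : EuclideanSpace ℝ (Fin d) → ℝ}, ContDiff ℝ ∞ g →
      HasCompactSupport g → (partialD i)^[n] (f ⋆[ContinuousLinearMap.lsmul ℝ ℝ] g) =
        f ⋆[ContinuousLinearMap.lsmul ℝ ℝ] (partialD i)^[n] g := by
    intro i n g hg hgc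
    induction n with
    | zero => rfl
    | succ n ih =>
      rw [Function.iterate_succ_apply', ih, partialD_convolution_right i hf
        (contDiff_iterate_partialD i n hg) (hasCompactSupport_iterate_partialD i n hgc),
        Function.iterate_succ_apply']
  have key : ∀ l : List (Fin d),
      ContDiff ℝ ∞ (l.foldr (fun i g => (partialD i)^[β i] g) g) ∧
      HasCompactSupport (l.foldr (fun i g => (partialD i)^[β i] g) g) ∧
      l.foldr (fun i g => (partialD i)^[β i] g) (f ⋆[ContinuousLinearMap.lsmul ℝ ℝ] g) =
        f ⋆[ContinuousLinearMap.lsmul ℝ ℝ] l.foldr (fun i g => (partialD i)^[β i] g) g := by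
    intro l
    induction l with
    | nil => exact ⟨hg, hgc, rfl⟩
    | cons i l ih =>
      obtain ⟨h1, h2, h3⟩ := ih
      refine ⟨contDiff_iterate_partialD i _ h1, hasCompactSupport_iterate_partialD i _ h2, ?_⟩
      simp only [List.foldr_cons, h3]
      exact iter i _ h1 h2
  exact (key _).2.2

theorem convolution_lsmul_comm (f g : EuclideanSpace ℝ (Fin d) → ℝ) :
    f ⋆[ContinuousLinearMap.lsmul ℝ ℝ] g = g ⋆[ContinuousLinearMap.lsmul ℝ ℝ] f := by
  have : (ContinuousLinearMap.lsmul ℝ ℝ : ℝ →L[ℝ] ℝ →L[ℝ] ℝ).flip =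
      ContinuousLinearMap.lsmul ℝ ℝ := by
    ext
    simp
  conv_rhs => rw [← this]
  exact (convolution_flip _).symm

theorem abs_convolution_le {f g : EuclideanSpace ℝ (Fin d) → ℝ} (hf : Integrable f) {A : ℝ}
    (hg : ∀ x, |g x| ≤ A) (x : EuclideanSpace ℝ (Fin d)) :
    |(f ⋆[ContinuousLinearMap.lsmul ℝ ℝ] g) x| ≤ (∫ t, |f t|) * A := by
  rw [convolution_def, ← integral_mul_const]
  rw [← Real.norm_eq_abs]
  refine norm_integral_le_of_norm_le (hf.abs.mul_const A) (Filter.Eventually.of_forall fun t => ?_)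
  simp only [ContinuousLinearMap.lsmul_apply, smul_eq_mul, norm_mul, Real.norm_eq_abs]
  exact mul_le_mul_of_nonneg_left (hg _) (abs_nonneg _)

/-- Mollification by a product kernel: every test function `ψ` has approximations `g` whose
derivatives satisfy the non-quasi-analytic bounds, and which are local averages of `ψ`. -/
theorem exists_mollification {c : ℕ → ℝ} (hc_pos : ∀ n, 0 < c n) (hc_mono : Monotone c)
    (hc : ¬ IsQuasiAnalytic c) {ψ : EuclideanSpace ℝ (Fin d) → ℝ} (hψ : ContDiff ℝ ∞ ψ)
    (hψc : HasCompactSupport ψ) {R : ℝ} (hR : ∀ x, R < ‖x‖ → ψ x = 0) {δ : ℝ} (hδ : 0 < δ) :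
    ∃ g : EuclideanSpace ℝ (Fin d) → ℝ, ContDiff ℝ ∞ g ∧ HasCompactSupport g ∧
      (∀ x, R + δ < ‖x‖ → g x = 0) ∧
      (∃ C, ∀ β x, |multiD β g x| ≤ C * ∏ i, ((1 / 2) ^ β i * c (β i))) ∧
      ∀ β x η, 0 ≤ η → (∀ y ∈ Metric.ball x δ, |multiD β ψ y - multiD β ψ x| ≤ η) →
        |multiD β g x - multiD β ψ x| ≤ η := by
  -- The cube of half-side `ε` lies in the ball of radius `(d + 1) ε = δ / 2 < δ`; using `d + 1`
  -- also covers `d = 0`.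
  set ε : ℝ := δ / (2 * (d + 1)) with hε
  have hε0 : 0 < ε := by positivity
  obtain ⟨φ, C, hφ, hφ0, hφs, hφi, hC, hφb⟩ :=
    exists_mollifier_of_not_isQuasiAnalytic hc_pos hc_mono hc hε0
  set κ : EuclideanSpace ℝ (Fin d) → ℝ := tensorFun fun _ => φ with hκ
  have hκd : ContDiff ℝ ∞ κ := contDiff_tensorFun fun _ => hφ
  have hκs : ∀ x, δ ≤ ‖x‖ → κ x = 0 := by
    intro x hx
    have : ∃ i, ε < |x i| := by
      by_contra! h
      have h1 := norm_le_of_abs_apply_le hε0.le h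
      have h2 : ((d : ℝ) + 1) * ε = δ / 2 := by rw [hε]; field_simp
      linarith
    obtain ⟨i, hi⟩ := this
    exact Finset.prod_eq_zero (Finset.mem_univ i) (hφs _ hi)
  have hκball : Function.support κ ⊆ Metric.ball 0 δ := fun x hx => by
    by_contra h
    exact hx (hκs x (by simpa using h))
  have hκc : HasCompactSupport κ := HasCompactSupport.intro
    (isCompact_closedBall (0 : EuclideanSpace ℝ (Fin d)) δ) fun x hx => hκs x (by
      have : δ < ‖x‖ := by simpa using hx
      exact this.le)
  have hκ0 : ∀ x, 0 ≤ κ x := fun x => Finset.prod_nonneg fun i _ => hφ0 _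
  have hκi : ∫ x, κ x = 1 := by rw [hκ, integral_tensorFun]; simp [hφi]
  refine ⟨κ ⋆[ContinuousLinearMap.lsmul ℝ ℝ] ψ,
    hψc.contDiff_convolution_right _ hκd.continuous.locallyIntegrable hψ,
    hκc.convolution _ hψc, fun x hx => ?_, ⟨(∫ t, |ψ t|) * C ^ d, fun β x => ?_⟩,
    fun β x η hη h => ?_⟩
  · by_contra hne
    obtain ⟨y, hy, z, hz, rfl⟩ := support_convolution_subset _ hne
    have h1 : ‖y‖ < δ := by simpa using hκball hy
    have h2 : ‖z‖ ≤ R := by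
      by_contra! h
      exact hz (hR z h)
    have := norm_add_le y z
    simp only at hx
    linarith
  -- For the size bounds all derivatives fall on the kernel, where they factor into one-dimensional
  -- ones.
  · rw [convolution_lsmul_comm, multiD_convolution_right β hψ.continuous hκd hκc,
      hκ, multiD_tensorFun fun _ => hφ, mul_assoc]
    refine abs_convolution_le (hψ.continuous.integrable_of_hasCompactSupport hψc) (fun t => ?_) x
    rw [tensorFun, Finset.abs_prod]
    refine (Finset.prod_le_prod (fun i _ => abs_nonneg _) fun i _ => hφb (β i) (t i)).trans_eq ?_
    rw [Finset.prod_mul_distrib, Finset.prod_const, Finset.card_univ, Fintype.card_fin]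
  -- For the approximation they fall on `ψ`, so the derivative of `g` is an average of that of `ψ`
  -- over a `δ`-ball.
  · rw [multiD_convolution_right β hκd.continuous hψ hψc]
    exact dist_convolution_le hη hκball hκ0 hκi
      (contDiff_multiD β hψ).continuous.aestronglyMeasurable h

end multiD

/-! ### Weighted norm estimates and density -/

section density

variable {d : ℕ}

theorem DProj.sobolevNorm_le {k : SobolevIndex d} {f : DProj d} {R W : ℝ} {A : (Fin d → ℕ) → ℝ}
    (hR : ∀ x, R < ‖x‖ → f x = 0) (hW : ∀ x, ‖x‖ ≤ R → k.weight x ≤ W)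
    (hA : ∀ β ∈ multiIndices d k.order, ∀ x, |multiD β f x| ≤ A β) :
    DProj.sobolevNorm k f ≤ √((∑ β ∈ multiIndices d k.order, A β ^ 2) *
      (W * volume.real (Metric.closedBall (0 : EuclideanSpace ℝ (Fin d)) R))) := by
  refine Real.sqrt_le_sqrt ?_
  rw [Finset.sum_mul]
  refine Finset.sum_le_sum fun β hβ => ?_
  have h1 : ∫ r, |multiD β f r| ^ 2 * k.weight r ≤
      ∫ r, (Metric.closedBall (0 : EuclideanSpace ℝ (Fin d)) R).indicator
        (fun _ => A β ^ 2 * W) r := by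
    refine integral_mono_of_nonneg
      (Filter.Eventually.of_forall fun r =>
        mul_nonneg (sq_nonneg _) (zero_le_one.trans (k.one_le r)))
      ((integrable_indicator_iff Metric.isClosed_closedBall.measurableSet).2
        (integrableOn_const measure_closedBall_lt_top.ne))
      (Filter.Eventually.of_forall fun r => ?_)
    by_cases hr : r ∈ Metric.closedBall (0 : EuclideanSpace ℝ (Fin d)) R
    · rw [Set.indicator_of_mem hr]
      exact mul_le_mul (pow_le_pow_left₀ (abs_nonneg _) (hA β hβ r) 2)
        (hW r (by simpa using hr)) (zero_le_one.trans (k.one_le r)) (sq_nonneg _)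
    · rw [Set.indicator_of_notMem hr]
      have hr' : R < ‖r‖ := by simpa using hr
      simp [multiD_eq_zero_of_lt_norm β hR r hr']
  refine h1.trans_eq ?_
  rw [integral_indicator Metric.isClosed_closedBall.measurableSet, setIntegral_const, smul_eq_mul]
  ring

theorem zero_mem_cube : (0 : EuclideanSpace ℝ (Fin d)) ∈ cube d := fun i => by simp

/-- The point `x = 0` of the cube is used. Compactness supplies the upper bounds without which the
real suprema would be meaningless. -/
theorem sqrt_le_supSqrtWeight {w : EuclideanSpace ℝ (Fin d) → ℝ} (hw : Continuous w) {n : ℕ}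
    {z : EuclideanSpace ℝ (Fin d)} (hz : ‖z‖ ≤ n) : √(w z) ≤ supSqrtWeight n w := by
  obtain ⟨M, hM⟩ := (isCompact_closedBall (0 : EuclideanSpace ℝ (Fin d))
    (n + (d + 1))).exists_bound_of_continuousOn (f := fun y => √(w y))
    (Real.continuous_sqrt.comp hw).continuousOn
  have hle : ∀ (z : Metric.closedBall (0 : EuclideanSpace ℝ (Fin d)) (n : ℝ)) (x : cube d),
      √(w ((z : EuclideanSpace ℝ (Fin d)) + (x : EuclideanSpace ℝ (Fin d)))) ≤ M := by
    intro z x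
    refine (le_abs_self _).trans (hM _ ?_)
    have h1 : ‖(z : EuclideanSpace ℝ (Fin d))‖ ≤ n := mem_closedBall_zero_iff.1 z.2
    have h2 : ‖(x : EuclideanSpace ℝ (Fin d))‖ ≤ (d + 1) * 1 :=
      norm_le_of_abs_apply_le zero_le_one fun i => abs_le.2 (x.2 i)
    rw [mem_closedBall_zero_iff]
    exact (norm_add_le _ _).trans (by linarith)
  have : Nonempty (cube d) := ⟨⟨0, zero_mem_cube⟩⟩
  have hz' : z ∈ Metric.closedBall (0 : EuclideanSpace ℝ (Fin d)) (n : ℝ) := by simpa using hz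
  refine le_ciSup_of_le ⟨M, ?_⟩ ⟨z, hz'⟩ (le_ciSup_of_le ⟨M, ?_⟩ ⟨0, zero_mem_cube⟩ ?_)
  · rintro _ ⟨z, rfl⟩
    exact ciSup_le (hle z)
  · rintro _ ⟨x, rfl⟩
    exact hle ⟨z, hz'⟩ x
  · simp

/-- Monotonicity replaces each `c (β i)` by `c K`. The remaining geometric factors, summed over the
full box of multi-indices, give at most `2` per coordinate, so the constant does not depend on `K`.
-/
theorem sum_multiIndices_sq_le {c : ℕ → ℝ} (hc_pos : ∀ n, 0 < c n) (hc_mono : Monotone c)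
    (C : ℝ) (K : ℕ) :
    ∑ β ∈ multiIndices d K, (C * ∏ i, ((1 / 2) ^ β i * c (β i))) ^ 2 ≤
      (C * c K ^ d) ^ 2 * 2 ^ d := by
  have h1 : ∀ β ∈ multiIndices d K, (C * ∏ i, ((1 / 2) ^ β i * c (β i))) ^ 2 ≤
      (C * c K ^ d) ^ 2 * ∏ i, (1 / 2 : ℝ) ^ β i := by
    intro β hβ
    have hβi : ∀ i, β i ≤ K := fun i =>
      (Finset.single_le_sum (f := β) (fun _ _ => Nat.zero_le _) (Finset.mem_univ i)).trans
        (mem_multiIndices.1 hβ)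
    have hp : ∏ i, c (β i) ≤ c K ^ d := by
      refine (Finset.prod_le_prod (fun i _ => (hc_pos _).le) fun i _ => hc_mono (hβi i)).trans_eq ?_
      simp
    have hp0 : 0 ≤ ∏ i, c (β i) := Finset.prod_nonneg fun i _ => (hc_pos _).le
    have hq0 : 0 ≤ ∏ i, (1 / 2 : ℝ) ^ β i := Finset.prod_nonneg fun i _ => by positivity
    have hq1 : ∏ i, (1 / 2 : ℝ) ^ β i ≤ 1 :=
      Finset.prod_le_one (fun i _ => by positivity) fun i _ =>
        pow_le_one₀ (by norm_num) (by norm_num)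
    rw [Finset.prod_mul_distrib, mul_pow, mul_pow, mul_pow, mul_assoc]
    refine mul_le_mul_of_nonneg_left ?_ (sq_nonneg C)
    rw [mul_comm ((c K ^ d) ^ 2)]
    refine mul_le_mul ?_ (pow_le_pow_left₀ hp0 hp 2) (sq_nonneg _) hq0
    nlinarith
  refine (Finset.sum_le_sum h1).trans ?_
  rw [← Finset.mul_sum]
  refine mul_le_mul_of_nonneg_left ?_ (sq_nonneg _)
  refine (Finset.sum_le_sum_of_subset_of_nonneg (Finset.filter_subset _ _) fun β _ _ =>
    Finset.prod_nonneg fun i _ => by positivity).trans ?_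
  rw [← Finset.prod_univ_sum (fun _ : Fin d => Finset.range (K + 1))
    (fun _ j => (1 / 2 : ℝ) ^ j)]
  refine (Finset.prod_le_prod (fun i _ => Finset.sum_nonneg fun j _ => by positivity)
    fun i _ => sum_geometric_two_le (K + 1)).trans_eq ?_
  simp

theorem mem_span_boundedTestFunctions {c : ℕ → ℝ} (hc_pos : ∀ n, 0 < c n) (hc_mono : Monotone c)
    (k : ℕ → SobolevIndex d) {f : DProj d} {C R : ℝ} (hR : ∀ x, R < ‖x‖ → f x = 0)
    (hC : ∀ β x, |multiD β f x| ≤ C * ∏ i, ((1 / 2) ^ β i * c (β i))) :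
    f ∈ Submodule.span ℝ (boundedTestFunctions c k) := by
  obtain ⟨N, hN⟩ := exists_nat_ge R
  set V := volume.real (Metric.closedBall (0 : EuclideanSpace ℝ (Fin d)) R) with hV
  set T : ℕ → ℝ := fun n => c (k n).order ^ d * supSqrtWeight n (k n).weight with hT
  have hS : ∀ n, 1 ≤ supSqrtWeight n (k n).weight := fun n => by
    refine le_trans ?_ (sqrt_le_supSqrtWeight (z := 0) (k n).smooth.continuous (by simp))
    rw [Real.one_le_sqrt]
    exact (k n).one_le 0
  have hTpos : ∀ n, 0 < T n := fun n =>
    mul_pos (pow_pos (hc_pos _) d) (zero_lt_one.trans_le (hS n))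
  set D₀ : ℝ := √(C ^ 2 * 2 ^ d * V) with hD₀
  -- For `n ≥ N ≥ R` the support lies in the ball of radius `n`, so the weight there is at most the
  -- square of its supremum, and `D₀` is independent of `n`.
  have hlarge : ∀ n, N ≤ n → DProj.sobolevNorm (k n) f ≤ D₀ * T n := by
    intro n hn
    have hn' : (N : ℝ) ≤ n := by exact_mod_cast hn
    refine (DProj.sobolevNorm_le hR (W := supSqrtWeight n (k n).weight ^ 2) (fun x hx => ?_)
      fun β _ => hC β).trans ?_
    · rw [← Real.sqrt_le_left (zero_le_one.trans (hS n))]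
      exact sqrt_le_supSqrtWeight (k n).smooth.continuous (by linarith)
    · rw [← Real.sqrt_sq (hTpos n).le, hD₀, ← Real.sqrt_mul (by positivity)]
      refine Real.sqrt_le_sqrt ?_
      refine (mul_le_mul_of_nonneg_right (sum_multiIndices_sq_le hc_pos hc_mono C _)
        (by positivity)).trans_eq ?_
      rw [hT]
      ring
  -- The sum dominates each of the finitely many ratios with `n < N`, and the `1` keeps `D`
  -- positive.
  set D : ℝ := 1 + D₀ + ∑ n ∈ Finset.range N, DProj.sobolevNorm (k n) f / T n with hD
  have hnn : ∀ n, 0 ≤ DProj.sobolevNorm (k n) f / T n := fun n =>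
    div_nonneg (Real.sqrt_nonneg _) (hTpos n).le
  have hsum0 : 0 ≤ ∑ n ∈ Finset.range N, DProj.sobolevNorm (k n) f / T n :=
    Finset.sum_nonneg fun n _ => hnn n
  have hD₀0 : 0 ≤ D₀ := Real.sqrt_nonneg _
  have hDpos : 0 < D := by positivity
  have hall : ∀ n, DProj.sobolevNorm (k n) f ≤ D * T n := by
    intro n
    rcases le_or_gt N n with h | h
    · refine (hlarge n h).trans (mul_le_mul_of_nonneg_right ?_ (hTpos n).le)
      rw [hD]
      linarith
    · rw [← div_le_iff₀ (hTpos n)]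
      refine (Finset.single_le_sum (fun n _ => hnn n) (Finset.mem_range.2 h)).trans ?_
      rw [hD]
      linarith
  have hmem : D⁻¹ • f ∈ boundedTestFunctions c k := fun n => by
    rw [DProj.sobolevNorm_smul, Real.norm_of_nonneg (inv_pos.2 hDpos).le, inv_mul_le_iff₀ hDpos]
    exact hall n
  rw [show f = D • D⁻¹ • f by rw [smul_smul, mul_inv_cancel₀ hDpos.ne', one_smul]]
  exact Submodule.smul_mem _ _ (Submodule.subset_span hmem)

/-- A smooth compactly supported function as an element of `DProj d`. -/
noncomputable def DProj.mk (f : EuclideanSpace ℝ (Fin d) → ℝ) (hf : ContDiff ℝ ∞ f)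
    (hfc : HasCompactSupport f) : DProj d :=
  (⟨f, hf, hfc, by simp⟩ : 𝓓((⊤ : TopologicalSpace.Opens (EuclideanSpace ℝ (Fin d))), ℝ))

theorem multiD_sub (β : Fin d → ℕ) (f g : DProj d) (x : EuclideanSpace ℝ (Fin d)) :
    multiD β (f - g) x = multiD β f x - multiD β g x := by
  have h : multiD β f = multiD β (⇑(f - g)) + multiD β g := by
    rw [← multiD_add β (f - g).contDiff g.contDiff, ← DProj.coe_add, sub_add_cancel]
  rw [h, Pi.add_apply, add_sub_cancel_right]
  rfl

theorem DProj.exists_mem_span_approx {c : ℕ → ℝ} (hc_pos : ∀ n, 0 < c n) (hc_mono : Monotone c)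
    (hc : ¬ IsQuasiAnalytic c) (k : ℕ → SobolevIndex d) (ψ : DProj d) {R : ℝ}
    (hR : ∀ x, R < ‖x‖ → ψ x = 0) {δ : ℝ} (hδ : 0 < δ) :
    ∃ g ∈ Submodule.span ℝ (boundedTestFunctions c k), (∀ x, R + δ < ‖x‖ → g x = 0) ∧
      ∀ β x η, 0 ≤ η → (∀ y ∈ Metric.ball x δ, |multiD β ψ y - multiD β ψ x| ≤ η) →
        |multiD β g x - multiD β ψ x| ≤ η := by
  obtain ⟨g, hg, hgc, hgs, ⟨C, hC⟩, happ⟩ :=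
    exists_mollification hc_pos hc_mono hc ψ.contDiff ψ.hasCompactSupport hR hδ
  exact ⟨DProj.mk g hg hgc, mem_span_boundedTestFunctions hc_pos hc_mono k hgs hC, hgs, happ⟩

end density

theorem lemma2p2 (d : ℕ) (c : ℕ → ℝ) (hc_pos : ∀ n, 0 < c n) (hc_mono : Monotone c)
    (hc : ¬ IsQuasiAnalytic c) (k : ℕ → SobolevIndex d) :
    IsTotalSet (boundedTestFunctions c k) := by
  intro ψ
  obtain ⟨R, hR⟩ : ∃ R, ∀ x, R < ‖x‖ → ψ x = 0 := by
    obtain ⟨R, hR⟩ := ψ.hasCompactSupport.isCompact.isBounded.exists_norm_le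
    refine ⟨R, fun x hx => ?_⟩
    by_contra h
    exact absurd (hR x (subset_tsupport _ h)) (not_le.2 hx)
  have hex := fun δ : Set.Ioi (0 : ℝ) =>
    DProj.exists_mem_span_approx hc_pos hc_mono hc k ψ hR δ.2
  choose G hGmem hGsupp hGapp using hex
  -- This filter expresses `δ → 0+` on the type of positive reals that parametrises the
  -- approximations.
  set l : Filter (Set.Ioi (0 : ℝ)) := Filter.comap Subtype.val (nhdsWithin 0 (Set.Ioi 0)) with hl
  have hlne : l.NeBot := by
    refine Filter.NeBot.comap_of_range_mem inferInstance ?_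
    rw [Subtype.range_coe]
    exact self_mem_nhdsWithin
  have hlsmall : ∀ δ > 0, ∀ᶠ t : Set.Ioi (0 : ℝ) in l, (t : ℝ) < δ := fun δ hδ =>
    Filter.tendsto_comap.eventually (nhdsWithin_le_nhds (Iio_mem_nhds hδ))
  refine mem_closure_of_tendsto (f := G) (b := l) ?_ (Filter.Eventually.of_forall hGmem)
  rw [(DProj.withSeminorms d).tendsto_nhds]
  intro κ r hr
  obtain ⟨W, hW⟩ := (isCompact_closedBall (0 : EuclideanSpace ℝ (Fin d))
    (R + 1)).exists_bound_of_continuousOn κ.smooth.continuous.continuousOn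
  set V := volume.real (Metric.closedBall (0 : EuclideanSpace ℝ (Fin d)) (R + 1)) with hV
  set m : ℝ := ((multiIndices d κ.order).card : ℝ) with hm
  set Q : ℝ := m * (|W| * V) with hQ
  have hQ0 : 0 ≤ Q := by positivity
  -- Below, the norm of the error is at most `η √Q`, which this choice makes smaller than `r` even
  -- when `Q = 0`.
  set η : ℝ := r / (√Q + 1) with hη
  have hη0 : 0 < η := by positivity
  have hunif : ∀ᶠ t : Set.Ioi (0 : ℝ) in l, ∀ β ∈ multiIndices d κ.order,
      ∀ x, ∀ y ∈ Metric.ball x (t : ℝ), |multiD β ψ y - multiD β ψ x| ≤ η := by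
    refine (Filter.eventually_all_finset _).2 fun β _ => ?_
    have huc := (hasCompactSupport_multiD β
      ψ.hasCompactSupport).uniformContinuous_of_continuous (contDiff_multiD β ψ.contDiff).continuous
    obtain ⟨δ, hδ, h⟩ := Metric.uniformContinuous_iff.1 huc η hη0
    filter_upwards [hlsmall δ hδ] with t ht x y hy
    exact (h (lt_trans hy ht)).le
  -- Taking `t < 1` confines all the approximations to the fixed ball of radius `R + 1`.
  filter_upwards [hunif, hlsmall 1 one_pos] with t ht ht1
  have hbound := DProj.sobolevNorm_le (k := κ) (f := G t - ψ) (R := R + 1) (W := |W|)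
    (A := fun _ => η) (fun x hx => ?_) (fun x hx => ?_) (fun β hβ x => ?_)
  · have h1 : (∑ _β ∈ multiIndices d κ.order, η ^ 2) * (|W| * V) = η ^ 2 * Q := by
      rw [Finset.sum_const, nsmul_eq_mul, hQ]
      ring
    rw [h1, Real.sqrt_mul (sq_nonneg η), Real.sqrt_sq hη0.le] at hbound
    refine hbound.trans_lt ?_
    rw [hη, div_mul_eq_mul_div, div_lt_iff₀ (by positivity)]
    nlinarith
  · have h1 : G t x = 0 := hGsupp t x (by linarith)
    have h2 : ψ x = 0 := hR x (by linarith)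
    change G t x - ψ x = 0
    rw [h1, h2, sub_zero]
  · exact ((le_abs_self _).trans (hW x (by simpa using hx))).trans (le_abs_self W)
  · have := hGapp t β x η hη0.le (ht β hβ x)
    rwa [← multiD_sub] at this
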